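/- **Setting.** A system of $n$ fermionic modes is described by $2n$ Hermitian Majorana operators $c_1,\dots,c_{2n}$ acting on a Hilbert space of dimension $2^n$, with $c_i^2=\mathbb I$ and $c_ic_j=-c_jc_i$ for $i\ne j$ (for definiteness, in the Jordan–Wigner representation). For $K=\{k_1<\dots<k_r\}\subseteq\{1,\dots,2n\}$ put $C_K=i^{r(r-1)/2}c_{k_1}\cdots c_{k_r}$. An *$n$-fermion state* is a positive semidefinite $\rho$ with $\mathrm{Tr}\,\rho=1$ that is an even polynomial in the $c_k$. A *Gaussian unitary* is a finite product of operators $\exp(-\omega c_{k_1}c_{k_2})$ with $\omega\in\mathbb R$, $k_1\neq k_2$. A *pure Gaussian state* is $V\,\prod_{j=1}^{n}\tfrac12\big(\mathbb I+(-1)^{s_j}i c_{2j-1}c_{2j}\big)\,V^\dagger$ with $V$ a Gaussian unitary and $s\in\{0,1\}^n$. *Circuits.* A *layer* is a product $W=\prod_{K}\exp(i\omega_K C_K)$ over pairwise disjoint sets $K$ with $|K|\in\{2,4\}$ and $\omega_K\in\mathbb R$. A *fermionic circuit of depth $T$ with free access to Gaussian operations* is $U=G_TW_TG_{T-1}W_{T-1}\cdots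 G_1W_1$ with layers $W_t$ and arbitrary Gaussian unitaries $G_t$ (so $U=\mathbb I$ if $T=0$). Such a circuit on $l+m$ modes *prepares* the $l$-fermion state $\rho$ using $m$ ancillary modes if, for some pure Gaussian state $\sigma_G$ on $l+m$ modes, $\rho=\mathrm{Tr}_{[2(l+m)]\setminus[2l]}(U\sigma_GU^\dagger)$, the fermionic partial trace over the last $m$ modes: in the expansion in the operators $C_K$, the terms with $K\not\subseteq[2l]$ are dropped and the remaining ones are multiplied by $2^m$. *Spread states.* For a Gaussian unitary $G$ and $s\in\{0,1\}^l$ let $$\pi_G(s)=G^\dagger\prod_{j=1}^{l}\frac{\mathbb I+(-1)^{s_j}\,i\,c_{2j-1}c_{2j}}{2}\,G,\qquad p_{G,\rho}(s)=\mathrm{Tr}(\pi_G(s)\rho).$$ An $l$-fermion state $\rho$ is *$(\mu,L)$-spread* if there are a Gaussian unitary $G$ and sets $S_1,S_2\subseteq\{0,1\}^l$ with $\sum_{s\in S_1}p_{G,\rho}(s)\ge\mu$, $\sum_{s\in S_2}p_{G,\rho}(s)\ge\mu$ and $\min_{s_1\in S_1,\,s_2\in S_2}|s_1-s_2|=L$,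 where $|\cdot|$ is the Hamming distance. **Lemma.** Let $\mu>0$ and let $\rho$ be a $(\mu,L)$-spread $l$-fermion state. Any fermionic circuit with free access to Gaussian operations that prepares $\rho$ using $m$ ancillary modes has depth $T$ satisfying $$T\;\ge\;\frac12\log_3\!\left(\frac{L^2}{1600\,(l+m)\,\log(1/\mu)}\right),$$ where $\log$ is the natural logarithm. (If $L\ge1$ then $\mu\le 1/2$ and $l\ge 1$, so the right-hand side is well defined; if $L=0$ the bound is read as the trivial one.) -/

import Mathlib

namespace FermiCircuit

open scoped ComplexOrder

/-- Operators on the Fock space of `n` fermionic modes; the basis vectors are the occupation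
strings `Fin n → Bool`. -/
abbrev FockOp (n : ℕ) : Type := Matrix (Fin n → Bool) (Fin n → Bool) ℂ

/-- The Majorana operators `c_0, …, c_{2n-1}` in the Jordan–Wigner form, numbered from `0`:
`c_{2j} = Z_0 ⋯ Z_{j-1} X_j` and `c_{2j+1} = Z_0 ⋯ Z_{j-1} Y_j`. They are Hermitian, square to `1`,
are traceless and anticommute pairwise; such a system on a space of dimension `2 ^ n` is unique
up to unitary equivalence. -/
noncomputable def majorana (n : ℕ) (k : Fin (2 * n)) : FockOp n :=
  Matrix.of fun s t =>
    let j : Fin n := ⟨k.val / 2, by omega⟩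
    if s = Function.update t j (!(t j)) then
      (∏ i : Fin n, if i < j ∧ t i = true then (-1 : ℂ) else 1) *
        (if k.val % 2 = 0 then 1 else if t j = true then -Complex.I else Complex.I)
    else 0

/-- The Hermitian Majorana monomial `C_K = i^{|K|(|K|-1)/2} c_{k_1} ⋯ c_{k_r}`,
where `K = {k_1 < ⋯ < k_r}`. -/
noncomputable def monomial (n : ℕ) (K : Finset (Fin (2 * n))) : FockOp n :=
  Complex.I ^ (K.card * (K.card - 1) / 2) • ((K.sort (· ≤ ·)).map (majorana n)).prod

/-- A fermionic state: a density operator that is an even polynomial in the Majorana operators. -/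
structure IsFermionicState (n : ℕ) (ρ : FockOp n) : Prop where
  posSemidef : ρ.PosSemidef
  trace_eq_one : ρ.trace = 1
  even : ρ ∈ Submodule.span ℂ {A : FockOp n | ∃ K, Even K.card ∧ A = monomial n K}

/-- Gaussian circuits: finite products of the unitaries `exp (-ω c_{k₁} c_{k₂})` with `ω` real
and `k₁ ≠ k₂`. -/
def IsGaussianUnitary (n : ℕ) (G : FockOp n) : Prop :=
  G ∈ Submonoid.closure {A : FockOp n | ∃ (ω : ℝ) (k₁ k₂ : Fin (2 * n)), k₁ ≠ k₂ ∧
    A = NormedSpace.exp (-((ω : ℂ) • (majorana n k₁ * majorana n k₂)))}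

/-- A layer `∏_K exp (i ω_K C_K)` over pairwise disjoint sets `K` with `|K| = 2` or `|K| = 4`.
The layer is given by the list of its gates; the factors commute, so their order is immaterial. -/
def IsLayer (n : ℕ) (W : FockOp n) : Prop :=
  ∃ gates : List (Finset (Fin (2 * n)) × ℝ),
    (∀ g ∈ gates, g.1.card = 2 ∨ g.1.card = 4) ∧
    gates.Pairwise (fun g h => Disjoint g.1 h.1) ∧
    W = (gates.map fun g => NormedSpace.exp ((Complex.I * (g.2 : ℂ)) • monomial n g.1)).prod

/-- `IsCircuit n T U`: the operator `U = G_T W_T ⋯ G_1 W_1` is a circuit of depth `T` with free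
access to Gaussian operations. -/
inductive IsCircuit (n : ℕ) : ℕ → FockOp n → Prop
  | nil : IsCircuit n 0 1
  | step {T : ℕ} {U W G : FockOp n} :
      IsCircuit n T U → IsLayer n W → IsGaussianUnitary n G → IsCircuit n (T + 1) (G * W * U)

/-- The operator `∏_j (1 + (-1)^{s_j} i c_{2j} c_{2j+1}) / 2`, with `j = 0, …, n-1`. -/
noncomputable def occupationProj (n : ℕ) (s : Fin n → Bool) : FockOp n :=
  ((List.finRange n).map fun j : Fin n =>
    (2⁻¹ : ℂ) • ((1 : FockOp n) + ((if s j = true then (-1 : ℂ) else 1) * Complex.I) •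
      (majorana n ⟨2 * j.val, by omega⟩ * majorana n ⟨2 * j.val + 1, by omega⟩))).prod

/-- The element `π_G(s)` of the POVM attached to the Gaussian unitary `G`. -/
noncomputable def povm (n : ℕ) (G : FockOp n) (s : Fin n → Bool) : FockOp n :=
  G.conjTranspose * occupationProj n s * G

/-- The probability `p_{G,ρ}(s) = Tr (π_G(s) ρ)` (a real number when `ρ` is a state). -/
noncomputable def outcomeProb (n : ℕ) (G ρ : FockOp n) (s : Fin n → Bool) : ℝ :=
  (povm n G s * ρ).trace.re

/-- `ρ` is `(μ, L)`-spread: in some Gaussian basis, two sets of bitstrings both have probability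
at least `μ`, and the minimal Hamming distance between them is `L`. -/
def IsSpread (n : ℕ) (μ : ℝ) (L : ℕ) (ρ : FockOp n) : Prop :=
  ∃ G : FockOp n, IsGaussianUnitary n G ∧ ∃ S₁ S₂ : Finset (Fin n → Bool),
    μ ≤ ∑ s ∈ S₁, outcomeProb n G ρ s ∧
    μ ≤ ∑ s ∈ S₂, outcomeProb n G ρ s ∧
    IsLeast {d : ℕ | ∃ s₁ ∈ S₁, ∃ s₂ ∈ S₂, hammingDist s₁ s₂ = d} L

/-- Pure Gaussian states: the images under Gaussian unitaries of the states
`∏_j (1 ± i c_{2j} c_{2j+1}) / 2`. The signs are free, so that both parities occur. -/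
def IsPureGaussianState (n : ℕ) (σ : FockOp n) : Prop :=
  ∃ V : FockOp n, IsGaussianUnitary n V ∧ ∃ s : Fin n → Bool,
    σ = V * occupationProj n s * V.conjTranspose

/-- The fermionic partial trace over the last `m` of `l + m` modes: in the expansion of `X` in
Majorana monomials, those that involve an ancillary Majorana operator are dropped and the others
are multiplied by `2 ^ m`. Since the coefficient of `C_K` in `X` is `Tr (C_K X) / 2 ^ (l + m)`,
the coefficient of `C_K` in the result is `Tr (C_K X) / 2 ^ l`. -/
noncomputable def partialTrace (l m : ℕ) (X : FockOp (l + m)) : FockOp l :=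
  ∑ K : Finset (Fin (2 * l)),
    (((2 : ℂ) ^ l)⁻¹ *
      (monomial (l + m) (K.map (Fin.castLEEmb (by omega : 2 * l ≤ 2 * (l + m)))) * X).trace) •
    monomial l K

/-- A depth-`T` fermionic circuit with `m` ancillary modes and free access to Gaussian operations
prepares `ρ` from some pure Gaussian state. -/
def IsPreparedBy (l m T : ℕ) (ρ : FockOp l) : Prop :=
  ∃ σ U : FockOp (l + m), IsPureGaussianState (l + m) σ ∧ IsCircuit (l + m) T U ∧
    ρ = partialTrace l m (U * σ * U.conjTranspose)

end FermiCircuit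

/-! Write `n = l + m` and `d = 3 ^ T`. Conjugating `c_k` by a gate `exp (iωC_K)` with `k ∈ K` gives
a combination of `c_k` and `C_K c_k`, and the latter has degree at most 3 because `c_k` cancels. The
supports in a layer are disjoint, so a layer multiplies degrees by at most 3, while Gaussian
unitaries preserve degree (`IsCircuit.hasDegree`). Once the measurement basis is absorbed into the
unitary, the state on all modes is `R = ∏_j (1 + A_j) / 2`, where each `A_j` is a Hermitian
reflection of degree at most `2d` and so changes at most `2d` bits of an occupation string.

Let `F` be the Hamming distance of the measured bits to `S₁`, and conjugate `R` by `e^{tF}`. Each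
factor stays idempotent and becomes non-Hermitian only to first order in `t`, so its norm exceeds 1
only to second order (`norm_tilt_projection_le`). The tilted `R` thus has norm at most `exp (32 n d²
t²)`. Undoing the tilt gains `e^{-tL}` on the block of `R` from `S₁` to `S₂` (`norm_block_le`).

Since `R` has rank one, the norm of that block is at least `μ` (`le_norm_of_rank_one`). Optimising
over `t` gives `μ ≤ exp (-L² / (128 n 9^T))` (`le_exp_of_spread`), and taking logarithms yields the
depth bound. -/

namespace FermiCircuit

/-! ### Norm estimates for matrices conjugated by `e^{zF}`. -/

section Tilt

set_option linter.unusedSectionVars false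

open Matrix
open scoped Matrix.Norms.L2Operator

variable {ι : Type*} [Fintype ι] [DecidableEq ι]

/-- The diagonal matrix `e^{zF}`. -/
noncomputable def expDiag (F : ι → ℤ) (z : ℂ) : Matrix ι ι ℂ :=
  diagonal fun s => Complex.exp (z * F s)

lemma expDiag_add (F : ι → ℤ) (z w : ℂ) : expDiag F (z + w) = expDiag F z * expDiag F w := by
  simp [expDiag, add_mul, Complex.exp_add]

@[simp] lemma expDiag_zero (F : ι → ℤ) : expDiag F 0 = 1 := by
  simp [expDiag]

lemma expDiag_mul_neg (F : ι → ℤ) (z : ℂ) : expDiag F z * expDiag F (-z) = 1 := by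
  rw [← expDiag_add, add_neg_cancel, expDiag_zero]

lemma expDiag_neg_mul (F : ι → ℤ) (z : ℂ) : expDiag F (-z) * expDiag F z = 1 := by
  rw [← expDiag_add, neg_add_cancel, expDiag_zero]

lemma expDiag_conjTranspose (F : ι → ℤ) (t : ℝ) : (expDiag F t)ᴴ = expDiag F t := by
  rw [expDiag, diagonal_conjTranspose]
  congr 1
  ext s
  simp [← Complex.exp_conj]

/-- The similarity transform `e^{zF} A e^{-zF}`. -/
noncomputable def tilt (F : ι → ℤ) (z : ℂ) (A : Matrix ι ι ℂ) : Matrix ι ι ℂ :=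
  expDiag F z * A * expDiag F (-z)

lemma tilt_apply (F : ι → ℤ) (z : ℂ) (A : Matrix ι ι ℂ) (s t : ι) :
    tilt F z A s t = A s t * Complex.exp (z * (F s - F t)) := by
  rw [tilt, expDiag, expDiag, mul_diagonal, diagonal_mul, mul_right_comm, ← Complex.exp_add,
    mul_comm]
  ring_nf

lemma tilt_mul (F : ι → ℤ) (z : ℂ) (A B : Matrix ι ι ℂ) :
    tilt F z (A * B) = tilt F z A * tilt F z B := by
  simp only [tilt]
  calc _ = expDiag F z * A * (expDiag F (-z) * expDiag F z) * B * expDiag F (-z) := by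
        rw [expDiag_neg_mul]; simp only [mul_assoc, one_mul]
    _ = _ := by simp only [mul_assoc]

lemma tilt_one (F : ι → ℤ) (z : ℂ) : tilt F z 1 = 1 := by
  rw [tilt, mul_one, expDiag_mul_neg]

lemma tilt_zero (F : ι → ℤ) (A : Matrix ι ι ℂ) : tilt F 0 A = A := by
  simp [tilt]

lemma tilt_neg (F : ι → ℤ) (z : ℂ) (A : Matrix ι ι ℂ) : tilt (-F) z A = tilt F (-z) A := by
  ext s t
  simp only [tilt_apply, Pi.neg_apply, Int.cast_neg]
  ring_nf

lemma tilt_conjTranspose (F : ι → ℤ) (t : ℝ) {A : Matrix ι ι ℂ} (hA : Aᴴ = A) :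
    (tilt F t A)ᴴ = tilt F (-t) A := by
  rw [tilt, tilt, conjTranspose_mul, conjTranspose_mul, hA, neg_neg, ← Complex.ofReal_neg,
    expDiag_conjTranspose, expDiag_conjTranspose, mul_assoc]

lemma norm_expDiag_le (F : ι → ℤ) {z : ℂ} (hz : z.re = 0) : ‖expDiag F z‖ ≤ 1 := by
  rw [expDiag, l2_opNorm_diagonal, pi_norm_le_iff_of_nonneg zero_le_one]
  intro s
  simp [Complex.norm_exp, hz]

lemma norm_tilt_le_of_re_eq_zero (F : ι → ℤ) {z : ℂ} (hz : z.re = 0) (A : Matrix ι ι ℂ) :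
    ‖tilt F z A‖ ≤ ‖A‖ := by
  have h1 := norm_expDiag_le F hz
  have h2 := norm_expDiag_le F (z := -z) (by simp [hz])
  calc _ ≤ ‖expDiag F z‖ * ‖A‖ * ‖expDiag F (-z)‖ :=
        (norm_mul_le _ _).trans (mul_le_mul_of_nonneg_right (norm_mul_le _ _) (norm_nonneg _))
    _ ≤ 1 * ‖A‖ * 1 := by gcongr
    _ = _ := by ring

/-- The tilt of a matrix of bandwidth `D`, renormalised to a polynomial in `w = e^{-z}`. -/
lemma tilt_eq_smul_of_band {F : ι → ℤ} {D : ℕ} {A : Matrix ι ι ℂ}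
    (hA : ∀ s t, A s t ≠ 0 → |F s - F t| ≤ D) (z : ℂ) :
    tilt F z A = Complex.exp (z * D) •
      ∑ s, ∑ t, (Complex.exp (-z) ^ (D + F t - F s).toNat) • single s t (A s t) := by
  ext s t
  have : (∑ s, ∑ t, (Complex.exp (-z) ^ (D + F t - F s).toNat) • single s t (A s t)) s t =
      Complex.exp (-z) ^ (D + F t - F s).toNat * A s t := by
    simp only [Matrix.sum_apply, Matrix.smul_apply, smul_eq_mul]
    rw [Finset.sum_eq_single s, Finset.sum_eq_single t]
    · simp
    · intro b _ hb; simp [hb]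
    · simp
    · intro b _ hb; exact Finset.sum_eq_zero fun c _ => by simp [hb]
    · simp
  rw [Matrix.smul_apply, this, tilt_apply, smul_eq_mul]
  by_cases h : A s t = 0
  · simp [h]
  · have hD := hA s t h
    rw [abs_le] at hD
    rw [← Complex.exp_nat_mul, ← mul_assoc, ← Complex.exp_add, mul_comm]
    congr 2
    have : (((D + F t - F s).toNat : ℤ) : ℂ) = ((D + F t - F s : ℤ) : ℂ) := by
      rw [Int.toNat_of_nonneg (by omega)]
    rw [Int.cast_natCast] at this
    rw [this]
    push_cast
    ring

/-- Maximum principle in `w = e^{-z}`: the renormalised tilt is a polynomial in `w`. On `|w| = 1` it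
has the norm of a conjugate of `A` by diagonal unitaries, and `Re z ≥ 0` means `|w| ≤ 1`. -/
lemma norm_tilt_le_of_re_nonneg {F : ι → ℤ} {D : ℕ} {A : Matrix ι ι ℂ}
    (hA : ∀ s t, A s t ≠ 0 → |F s - F t| ≤ D) {z : ℂ} (hz : 0 ≤ z.re) :
    ‖tilt F z A‖ ≤ Real.exp (z.re * D) * ‖A‖ := by
  set f : ℂ → Matrix ι ι ℂ := fun w =>
    ∑ s, ∑ t, (w ^ (D + F t - F s).toNat) • single s t (A s t) with hf
  have hfd : Differentiable ℂ f := by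
    rw [hf]; fun_prop
  have key : ‖f (Complex.exp (-z))‖ ≤ ‖A‖ := by
    refine Complex.norm_le_of_forall_mem_frontier_norm_le (U := Metric.ball 0 1)
      Metric.isBounded_ball hfd.diffContOnCl (fun w hw => ?_) ?_
    · rw [frontier_ball _ one_ne_zero, mem_sphere_zero_iff_norm] at hw
      have hw0 : w ≠ 0 := by rintro rfl; simp at hw
      have hre : (-Complex.log w).re = 0 := by simp [Complex.log_re, hw]
      have h1 := tilt_eq_smul_of_band hA (-Complex.log w)
      rw [neg_neg, Complex.exp_log hw0] at h1
      have h2 := norm_tilt_le_of_re_eq_zero F hre A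
      have h3 : Real.exp (-Complex.log w * D).re = 1 := by
        rw [Real.exp_eq_one_iff]; simp [Complex.log_re, hw]
      rwa [h1, norm_smul, Complex.norm_exp, h3, one_mul] at h2
    · rw [closure_ball _ one_ne_zero, mem_closedBall_zero_iff, Complex.norm_exp]
      simpa using hz
  rw [tilt_eq_smul_of_band hA, norm_smul, Complex.norm_exp]
  refine mul_le_mul (by simp) key (norm_nonneg _) (Real.exp_pos _).le

lemma norm_tilt_le {F : ι → ℤ} {D : ℕ} {A : Matrix ι ι ℂ}
    (hA : ∀ s t, A s t ≠ 0 → |F s - F t| ≤ D) (z : ℂ) :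
    ‖tilt F z A‖ ≤ Real.exp (|z.re| * D) * ‖A‖ := by
  rcases le_total 0 z.re with hz | hz
  · rw [abs_of_nonneg hz]
    exact norm_tilt_le_of_re_nonneg hA hz
  · have := norm_tilt_le_of_re_nonneg (F := -F) (D := D) (A := A) (z := -z)
      (fun s t h => by
        have := hA s t h
        rw [abs_sub_comm] at this
        simpa [neg_add_eq_sub] using this) (by simpa using hz)
    rw [tilt_neg, neg_neg] at this
    rw [abs_of_nonpos hz]
    simpa using this

/-- Schwarz lemma on the disc of radius `1 / D`. There the tilt has norm at most `e‖A‖ ≤ 3‖A‖`, so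
it stays within `4‖A‖` of its value `A` at the centre. -/
lemma norm_tilt_sub_le {F : ι → ℤ} {D : ℕ} (hD : 0 < D) {A : Matrix ι ι ℂ}
    (hA : ∀ s t, A s t ≠ 0 → |F s - F t| ≤ D) {z : ℂ} (hz : ‖z‖ * D < 1) :
    ‖tilt F z A - A‖ ≤ 4 * ‖A‖ * D * ‖z‖ := by
  have hD' : (0 : ℝ) < D := by exact_mod_cast hD
  have hd : Differentiable ℂ fun z => tilt F z A := by
    have : (fun z => tilt F z A) = fun z => Complex.exp (z * D) •
      ∑ s, ∑ t, (Complex.exp (-z) ^ (D + F t - F s).toNat) • single s t (A s t) :=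
      funext fun z => tilt_eq_smul_of_band hA z
    rw [this]
    fun_prop
  have hmaps : Set.MapsTo (fun z => tilt F z A) (Metric.ball 0 (1 / D))
      (Metric.closedBall (tilt F 0 A) (4 * ‖A‖)) := by
    intro w hw
    rw [mem_ball_zero_iff, lt_div_iff₀ hD'] at hw
    rw [mem_closedBall_iff_norm, tilt_zero]
    have h1 : |w.re| * D ≤ 1 :=
      (mul_le_mul_of_nonneg_right (Complex.abs_re_le_norm w) hD'.le).trans hw.le
    have h2 : Real.exp (|w.re| * D) ≤ 3 :=
      (Real.exp_le_exp.2 h1).trans (by linarith [Real.exp_one_lt_d9])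
    calc _ ≤ ‖tilt F w A‖ + ‖A‖ := norm_sub_le _ _
      _ ≤ 3 * ‖A‖ + ‖A‖ := by
        gcongr
        exact (norm_tilt_le hA w).trans (by gcongr)
      _ = _ := by ring
  have := Complex.dist_le_div_mul_dist_of_mapsTo_ball hd.differentiableOn hmaps
    (z := z) (by rwa [mem_ball_zero_iff, lt_div_iff₀ hD'])
  rw [tilt_zero, dist_eq_norm, dist_zero_right] at this
  refine this.trans_eq ?_
  field_simp

/-- The norm of an idempotent is controlled by its failure to be Hermitian. -/
lemma norm_sq_le_of_idempotent {p : Matrix ι ι ℂ} (hp : p * p = p) :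
    ‖p‖ ^ 2 ≤ 1 + ‖p - pᴴ‖ ^ 2 := by
  rcases eq_or_ne p 0 with rfl | hp0
  · simp
  have hpos : 0 < ‖p‖ := norm_pos_iff.2 hp0
  have hp' : pᴴ * pᴴ = pᴴ := by rw [← conjTranspose_mul, hp]
  -- `p * pᴴ` fails to be idempotent exactly by a term quadratic in `p - pᴴ`. With the C*-identity
  -- this becomes `‖p‖⁴ ≤ ‖p‖² (1 + ‖p - pᴴ‖²)`.
  have key : (p * pᴴ) * (p * pᴴ) = p * pᴴ + p * ((p - pᴴ)ᴴ * (p - pᴴ)) * pᴴ := by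
    rw [conjTranspose_sub, conjTranspose_conjTranspose]
    have : (pᴴ - p) * (p - pᴴ) = pᴴ * p - pᴴ - p + p * pᴴ := by
      rw [sub_mul, mul_sub, mul_sub, hp, hp']; abel
    rw [this]
    simp only [mul_add, mul_sub, add_mul, sub_mul]
    rw [show p * (p * pᴴ) * pᴴ = p * pᴴ by
      rw [← mul_assoc, hp, mul_assoc, hp'], show p * pᴴ * pᴴ = p * pᴴ by rw [mul_assoc, hp'], hp]
    simp only [mul_assoc]
    abel
  have hn : ‖p * pᴴ‖ = ‖p‖ ^ 2 := by
    rw [sq]; exact CStarRing.norm_self_mul_star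
  have hn2 : ‖(p * pᴴ) * (p * pᴴ)‖ = (‖p‖ ^ 2) ^ 2 := by
    have : (p * pᴴ) * (p * pᴴ) = (p * pᴴ) * (p * pᴴ)ᴴ := by
      rw [conjTranspose_mul, conjTranspose_conjTranspose]
    rw [this, ← hn, sq]; exact CStarRing.norm_self_mul_star
  have hB : ‖(p - pᴴ)ᴴ * (p - pᴴ)‖ = ‖p - pᴴ‖ ^ 2 := by
    rw [sq]; exact CStarRing.norm_star_mul_self
  have hle : (‖p‖ ^ 2) ^ 2 ≤ ‖p‖ ^ 2 * (1 + ‖p - pᴴ‖ ^ 2) := by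
    rw [← hn2, key]
    calc _ ≤ ‖p * pᴴ‖ + ‖p‖ * ‖(p - pᴴ)ᴴ * (p - pᴴ)‖ * ‖pᴴ‖ :=
          (norm_add_le _ _).trans (by
            gcongr
            exact (norm_mul_le _ _).trans
              (mul_le_mul_of_nonneg_right (norm_mul_le _ _) (norm_nonneg _)))
      _ = _ := by rw [hn, hB, l2_opNorm_conjTranspose]; ring
  have : 0 < ‖p‖ ^ 2 := by positivity
  nlinarith

lemma norm_le_one_of_reflection {A : Matrix ι ι ℂ} (hA : Aᴴ = A) (hA2 : A * A = 1) :
    ‖A‖ ≤ 1 := by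
  cases isEmpty_or_nonempty ι
  · rw [Subsingleton.elim A 0]; simp
  have h : ‖A‖ * ‖A‖ = 1 := by
    have := CStarRing.norm_star_mul_self (x := A)
    rw [← this, star_eq_conjTranspose, hA, hA2, CStarRing.norm_one]
  nlinarith [norm_nonneg A]

/-- A similarity keeps the projection idempotent, so only its skew part, of size `O(Dt)`, can raise
the norm above 1, and it enters squared. This quadratic dependence on `t` is the source of `L²` in
the final bound. -/
lemma norm_tilt_projection_le {F : ι → ℤ} {D : ℕ} (hD : 0 < D) {A : Matrix ι ι ℂ}
    (hband : ∀ s t, A s t ≠ 0 → |F s - F t| ≤ D) (hA : Aᴴ = A) (hA2 : A * A = 1)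
    {t : ℝ} (ht : 0 ≤ t) (htD : t * D < 1) :
    ‖tilt F t ((2⁻¹ : ℂ) • (1 + A))‖ ≤ Real.exp (8 * D ^ 2 * t ^ 2) := by
  set q : Matrix ι ι ℂ := (2⁻¹ : ℂ) • (1 + A) with hq
  have hqq : q * q = q := by
    rw [hq, smul_mul_smul_comm, add_mul, one_mul, mul_add, mul_one, hA2,
      show (1 + A + (A + 1) : Matrix ι ι ℂ) = (2 : ℂ) • (1 + A) by rw [two_smul]; abel, smul_smul]
    norm_num
  have hqh : qᴴ = q := by
    rw [hq, conjTranspose_smul, conjTranspose_add, hA, conjTranspose_one]; simp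
  have hlin : ∀ z, tilt F z q = (2⁻¹ : ℂ) • (1 + tilt F z A) := by
    intro z
    rw [hq, tilt, tilt]
    simp only [mul_smul_comm, smul_mul_assoc, mul_add, add_mul, mul_one, expDiag_mul_neg]
  have h1 := norm_sq_le_of_idempotent (p := tilt F t q) (by rw [← tilt_mul, hqq])
  have hA1 := norm_le_one_of_reflection hA hA2
  have hnt : ‖(t : ℂ)‖ = t := by simp [abs_of_nonneg ht]
  have hb : ∀ z : ℂ, ‖z‖ = t → ‖tilt F z A - A‖ ≤ 4 * (D * t) := by
    intro z hz
    refine (norm_tilt_sub_le hD hband (by rwa [hz])).trans ?_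
    rw [hz]
    have : 0 ≤ D * t := by positivity
    nlinarith
  -- The adjoint of the tilt at `t` is the tilt at `-t`. Both tilts of `A` lie within `4Dt` of `A`,
  -- and the factor `1/2` in `q` halves the total `8Dt`.
  have h2 : ‖tilt F t q - (tilt F t q)ᴴ‖ ≤ 4 * (D * t) := by
    rw [tilt_conjTranspose F t hqh, hlin, hlin, ← smul_sub, add_sub_add_left_eq_sub, norm_smul]
    have e1 := hb t hnt
    have e2 := hb (-t) (by rw [norm_neg, hnt])
    have e3 : ‖tilt F t A - tilt F (-t) A‖ ≤ 4 * (D * t) + 4 * (D * t) := by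
      rw [show tilt F t A - tilt F (-t) A = (tilt F t A - A) - (tilt F (-t) A - A) by abel]
      exact (norm_sub_le _ _).trans (add_le_add e1 e2)
    norm_num
    linarith
  have h3 : ‖tilt F t q‖ ^ 2 ≤ (Real.exp (8 * D ^ 2 * t ^ 2)) ^ 2 := by
    rw [← Real.exp_nat_mul]
    have e := Real.add_one_le_exp (((2 : ℕ) : ℝ) * (8 * D ^ 2 * t ^ 2))
    have : ‖tilt F t q - (tilt F t q)ᴴ‖ ^ 2 ≤ (4 * (D * t)) ^ 2 := by gcongr
    push_cast at e ⊢
    nlinarith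
  exact le_of_sq_le_sq h3 (Real.exp_pos _).le

lemma norm_list_prod_le_pow {l : List (Matrix ι ι ℂ)} {c : ℝ} (hc : 1 ≤ c)
    (h : ∀ q ∈ l, ‖q‖ ≤ c) : ‖l.prod‖ ≤ c ^ l.length := by
  induction l with
  | nil =>
    cases isEmpty_or_nonempty ι
    · rw [Subsingleton.elim (List.prod []) (0 : Matrix ι ι ℂ)]; simp
    · simp
  | cons a l ih =>
    rw [List.prod_cons, List.length_cons, pow_succ']
    exact (norm_mul_le _ _).trans (mul_le_mul (h a (by simp))
      (ih fun q hq => h q (by simp [hq])) (norm_nonneg _) (by linarith))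

lemma tilt_list_prod (F : ι → ℤ) (z : ℂ) (l : List (Matrix ι ι ℂ)) :
    tilt F z l.prod = (l.map (tilt F z)).prod := by
  induction l with
  | nil => simp [tilt_one]
  | cons a l ih => rw [List.prod_cons, tilt_mul, ih, List.map_cons, List.prod_cons]

/-- The diagonal projection onto the coordinates in `S`. -/
noncomputable def diagProj (S : Set ι) [DecidablePred (· ∈ S)] : Matrix ι ι ℂ :=
  diagonal fun s => if s ∈ S then 1 else 0

lemma diagProj_conjTranspose (S : Set ι) [DecidablePred (· ∈ S)] :
    (diagProj S)ᴴ = diagProj S := by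
  rw [diagProj, diagonal_conjTranspose]
  congr 1
  ext s
  by_cases h : s ∈ S <;> simp [h]

lemma diagProj_mul_self (S : Set ι) [DecidablePred (· ∈ S)] :
    diagProj S * diagProj S = diagProj S := by
  simp [diagProj]

/-- The weight `e^{tF}` equals 1 on `S₁`, while `e^{-tF}` is at most `e^{-tL}` on `S₂`, so undoing
the tilt shrinks this block. -/
lemma norm_diagProj_mul_le {F : ι → ℤ} {L : ℕ} {S₁ S₂ : Set ι} [DecidablePred (· ∈ S₁)]
    [DecidablePred (· ∈ S₂)] (h₁ : ∀ s ∈ S₁, F s = 0) (h₂ : ∀ s ∈ S₂, (L : ℤ) ≤ F s)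
    (R : Matrix ι ι ℂ) {t : ℝ} (ht : 0 ≤ t) :
    ‖diagProj S₂ * R * diagProj S₁‖ ≤ Real.exp (-(t * L)) * ‖tilt F t R‖ := by
  have e1 : expDiag F t * diagProj S₁ = diagProj S₁ := by
    rw [expDiag, diagProj, diagonal_mul_diagonal]
    congr 1
    ext s
    by_cases h : s ∈ S₁ <;> simp [h, h₁]
  have e2 : R = expDiag F (-t) * tilt F t R * expDiag F t := by
    rw [tilt, show expDiag F (-t) * (expDiag F t * R * expDiag F (-t)) * expDiag F t =
      (expDiag F (-t) * expDiag F t) * R * (expDiag F (-t) * expDiag F t) by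
        simp only [mul_assoc], expDiag_neg_mul, one_mul, mul_one]
  have n1 : ‖diagProj S₁‖ ≤ 1 := by
    rw [diagProj, l2_opNorm_diagonal, pi_norm_le_iff_of_nonneg zero_le_one]
    intro s
    by_cases h : s ∈ S₁ <;> simp [h]
  have n2 : ‖diagProj S₂ * expDiag F (-t)‖ ≤ Real.exp (-(t * L)) := by
    rw [expDiag, diagProj, diagonal_mul_diagonal, l2_opNorm_diagonal,
      pi_norm_le_iff_of_nonneg (Real.exp_pos _).le]
    intro s
    by_cases h : s ∈ S₂
    · have hF : (L : ℝ) ≤ F s := by exact_mod_cast h₂ s h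
      simp only [h, if_true, one_mul, Complex.norm_exp]
      refine Real.exp_le_exp.2 ?_
      simp only [Complex.mul_re, Complex.neg_re, Complex.ofReal_re, Complex.intCast_re,
        Complex.neg_im, Complex.ofReal_im, Complex.intCast_im]
      nlinarith
    · simp [h, (Real.exp_pos _).le]
  calc ‖diagProj S₂ * R * diagProj S₁‖
      = ‖diagProj S₂ * expDiag F (-t) * tilt F t R * diagProj S₁‖ := by
        conv_lhs => rw [e2]
        rw [show diagProj S₂ * (expDiag F (-t) * tilt F t R * expDiag F t) * diagProj S₁ =
          diagProj S₂ * expDiag F (-t) * tilt F t R * (expDiag F t * diagProj S₁) by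
            simp only [mul_assoc], e1]
    _ ≤ ‖diagProj S₂ * expDiag F (-t)‖ * ‖tilt F t R‖ * ‖diagProj S₁‖ :=
        (norm_mul_le _ _).trans (mul_le_mul_of_nonneg_right (norm_mul_le _ _) (norm_nonneg _))
    _ ≤ Real.exp (-(t * L)) * ‖tilt F t R‖ * 1 := by gcongr
    _ = _ := mul_one _

lemma le_of_mul_self_bounds {a b c μ : ℝ} (hμ : 0 < μ) (ha : 0 ≤ a) (hb : 0 ≤ b)
    (h₁ : μ ≤ a * a) (h₂ : μ ≤ b * b) (h : b * b * (a * a) ≤ b * c * a) : μ ≤ c := by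
  have ha : 0 < a := ha.lt_of_ne (by rintro rfl; linarith)
  have hb : 0 < b := hb.lt_of_ne (by rintro rfl; linarith)
  have h4 : b * a ≤ c :=
    le_of_mul_le_mul_left (by linarith : b * a * (b * a) ≤ (b * a) * c) (by positivity)
  refine le_trans (le_of_sq_le_sq ?_ (by positivity)) h4
  calc μ ^ 2 = μ * μ := sq μ
    _ ≤ (b * b) * (a * a) := by gcongr
    _ = _ := by ring

/-- For a rank-one projection `R`, the off-diagonal block of `R` between two projections is
at least as large as the smaller of the two probabilities. -/
lemma le_norm_of_rank_one {R P₁ P₂ : Matrix ι ι ℂ} (hR : Rᴴ = R) (hR2 : R * R = R)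
    (hrank : ∀ X, R * X * R = (X * R).trace • R)
    (hP₁ : P₁ᴴ = P₁) (hP₁2 : P₁ * P₁ = P₁) (hP₂ : P₂ᴴ = P₂) (hP₂2 : P₂ * P₂ = P₂)
    {μ : ℝ} (hμ : 0 < μ) (h₁ : μ ≤ (P₁ * R).trace.re) (h₂ : μ ≤ (P₂ * R).trace.re) :
    μ ≤ ‖P₂ * R * P₁‖ := by
  have hR0 : R ≠ 0 := by
    rintro rfl
    simp at h₁; linarith
  have hRn : ‖R‖ = 1 := by
    have : ‖R‖ * ‖R‖ = ‖R‖ := by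
      rw [← CStarRing.norm_star_mul_self, star_eq_conjTranspose, hR, hR2]
    exact mul_left_cancel₀ (norm_ne_zero_iff.2 hR0) (by rw [this, mul_one])
  have n1 : ‖R * P₁‖ * ‖R * P₁‖ = ‖(P₁ * R).trace‖ := by
    rw [← CStarRing.norm_self_mul_star, star_eq_conjTranspose, conjTranspose_mul, hR, hP₁,
      show R * P₁ * (P₁ * R) = R * (P₁ * P₁) * R by simp only [mul_assoc], hP₁2, hrank, norm_smul,
      hRn, mul_one]
  have n2 : ‖R * P₂‖ * ‖R * P₂‖ = ‖(P₂ * R).trace‖ := by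
    rw [← CStarRing.norm_self_mul_star, star_eq_conjTranspose, conjTranspose_mul, hR, hP₂,
      show R * P₂ * (P₂ * R) = R * (P₂ * P₂) * R by simp only [mul_assoc], hP₂2, hrank, norm_smul,
      hRn, mul_one]
  have n1' : ‖P₁ * R‖ = ‖R * P₁‖ := by
    rw [← l2_opNorm_conjTranspose, conjTranspose_mul, hR, hP₁]
  -- The product of the two probabilities is the norm of `R P₂ R P₁ R`, which contains the block `P₂
  -- R P₁`. The outer factors have norms equal to the square roots of the probabilities.
  have n3 : ‖(P₂ * R).trace‖ * ‖(P₁ * R).trace‖ ≤ ‖R * P₂‖ * ‖P₂ * R * P₁‖ * ‖R * P₁‖ := by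
    rw [← n1']
    calc _ = ‖R * P₂ * (P₂ * R * P₁) * (P₁ * R)‖ := by
          rw [show R * P₂ * (P₂ * R * P₁) * (P₁ * R) = R * (P₂ * P₂) * R * (P₁ * P₁) * R by
            simp only [mul_assoc], hP₁2, hP₂2, hrank P₂, smul_mul_assoc, smul_mul_assoc, hrank P₁,
            norm_smul, norm_smul, hRn, mul_one]
      _ ≤ _ := (norm_mul_le _ _).trans
          (mul_le_mul_of_nonneg_right (norm_mul_le _ _) (norm_nonneg _))
  have g1 := h₁.trans (Complex.re_le_norm _)
  have g2 := h₂.trans (Complex.re_le_norm _)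
  rw [← n1] at g1 n3
  rw [← n2] at g2 n3
  exact le_of_mul_self_bounds hμ (norm_nonneg _) (norm_nonneg _) g1 g2 n3

end Tilt

/-! ### Majorana algebra, polynomial degree and bandwidth. -/

section Majorana

open Matrix

variable {n : ℕ}

/-- The occupation string `t` with the `j`-th bit flipped. -/
def flipBit (j : Fin n) (t : Fin n → Bool) : Fin n → Bool :=
  Function.update t j (!(t j))

/-- The Jordan–Wigner sign `∏_{i < j} (-1)^{t_i}`. -/
noncomputable def jwSign (j : Fin n) (t : Fin n → Bool) : ℂ :=
  ∏ i : Fin n, if i < j ∧ t i = true then (-1 : ℂ) else 1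

/-- The phase of the Pauli matrix `X` or `Y`. -/
noncomputable def pauliPhase (k : ℕ) (b : Bool) : ℂ :=
  if k % 2 = 0 then 1 else if b = true then -Complex.I else Complex.I

/-- The weighted permutation matrix with nonzero entries `v t` at `(f t, t)`. -/
noncomputable def shiftOp (f : (Fin n → Bool) → (Fin n → Bool)) (v : (Fin n → Bool) → ℂ) :
    FockOp n :=
  Matrix.of fun s t => if s = f t then v t else 0

lemma shiftOp_mul (f g : (Fin n → Bool) → (Fin n → Bool)) (v w : (Fin n → Bool) → ℂ) :
    shiftOp f v * shiftOp g w = shiftOp (f ∘ g) fun t => v (g t) * w t := by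
  ext s t
  simp only [shiftOp, mul_apply, of_apply, Function.comp_apply]
  rw [Finset.sum_eq_single (g t)]
  · simp
  · intro b _ hb; simp [hb]
  · simp

/-- The mode of the Majorana operator `c_k`. -/
def mode (k : Fin (2 * n)) : Fin n := ⟨k.val / 2, by omega⟩

lemma majorana_eq (k : Fin (2 * n)) :
    majorana n k = shiftOp (flipBit (mode k))
      fun t => jwSign (mode k) t * pauliPhase k.val (t (mode k)) := rfl

lemma flipBit_comm (i j : Fin n) (t : Fin n → Bool) :
    flipBit i (flipBit j t) = flipBit j (flipBit i t) := by
  rcases eq_or_ne i j with rfl | h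
  · rfl
  · simp only [flipBit, Function.update_of_ne h, Function.update_of_ne h.symm]
    exact Function.update_comm h.symm _ _ _

lemma flipBit_flipBit (j : Fin n) (t : Fin n → Bool) : flipBit j (flipBit j t) = t := by
  simp [flipBit]

lemma flipBit_apply_self (j : Fin n) (t : Fin n → Bool) : flipBit j t j = !(t j) := by
  simp [flipBit]

lemma flipBit_apply_of_ne {i j : Fin n} (h : i ≠ j) (t : Fin n → Bool) : flipBit j t i = t i := by
  simp [flipBit, h]

lemma jwSign_flipBit_of_le {i j : Fin n} (h : j ≤ i) (t : Fin n → Bool) :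
    jwSign j (flipBit i t) = jwSign j t := by
  refine Finset.prod_congr rfl fun x _ => ?_
  by_cases hx : x < j
  · rw [flipBit_apply_of_ne (hx.trans_le h).ne]
  · simp [hx]

lemma jwSign_flipBit_of_lt {i j : Fin n} (h : i < j) (t : Fin n → Bool) :
    jwSign j (flipBit i t) = -jwSign j t := by
  rw [jwSign, jwSign, ← Finset.mul_prod_erase _ _ (Finset.mem_univ i),
    ← Finset.mul_prod_erase _ _ (Finset.mem_univ i), flipBit_apply_self, ← neg_mul]
  congr 1
  · cases t i <;> simp [h]
  · refine Finset.prod_congr rfl fun x hx => ?_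
    rw [flipBit_apply_of_ne (Finset.ne_of_mem_erase hx)]

lemma jwSign_mul_self (j : Fin n) (t : Fin n → Bool) : jwSign j t * jwSign j t = 1 := by
  rw [jwSign, ← Finset.prod_mul_distrib]
  refine Finset.prod_eq_one fun x _ => ?_
  split_ifs <;> simp

lemma star_jwSign (j : Fin n) (t : Fin n → Bool) : star (jwSign j t) = jwSign j t := by
  rw [jwSign, star_prod]
  refine Finset.prod_congr rfl fun x _ => ?_
  split_ifs <;> simp

lemma pauliPhase_not_mul (k : ℕ) (b : Bool) : pauliPhase k (!b) * pauliPhase k b = 1 := by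
  unfold pauliPhase
  cases b <;> split_ifs <;> simp_all

lemma star_pauliPhase (k : ℕ) (b : Bool) : star (pauliPhase k b) = pauliPhase k (!b) := by
  unfold pauliPhase
  cases b <;> split_ifs <;> simp_all

lemma majorana_mul_self (k : Fin (2 * n)) : majorana n k * majorana n k = 1 := by
  rw [majorana_eq, shiftOp_mul]
  ext s t
  simp only [shiftOp, of_apply, Function.comp_apply, flipBit_flipBit, flipBit_apply_self,
    jwSign_flipBit_of_le le_rfl]
  rw [mul_mul_mul_comm, jwSign_mul_self, pauliPhase_not_mul, one_apply, one_mul]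

lemma majorana_conjTranspose (k : Fin (2 * n)) : (majorana n k)ᴴ = majorana n k := by
  ext s t
  simp only [conjTranspose_apply, majorana_eq, shiftOp, of_apply]
  by_cases h : t = flipBit (mode k) s
  · have h' : s = flipBit (mode k) t := by rw [h, flipBit_flipBit]
    rw [if_pos h, if_pos h', h, star_mul', star_jwSign, star_pauliPhase, flipBit_apply_self,
      jwSign_flipBit_of_le le_rfl]
  · have h' : ¬ s = flipBit (mode k) t := fun e => h (by rw [e, flipBit_flipBit])
    rw [if_neg h, if_neg h', star_zero]

lemma majorana_anticomm {k k' : Fin (2 * n)} (h : k ≠ k') :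
    majorana n k * majorana n k' = -(majorana n k' * majorana n k) := by
  wlog hle : mode k ≤ mode k' generalizing k k'
  · rw [this h.symm (le_of_not_ge hle), neg_neg]
  rw [majorana_eq, majorana_eq, shiftOp_mul, shiftOp_mul]
  ext s t
  simp only [shiftOp, of_apply, Function.comp_apply, Matrix.neg_apply,
    flipBit_comm (mode k') (mode k)]
  split_ifs
  -- For distinct modes the sign comes from the Jordan–Wigner string of the later mode, which sees
  -- the earlier flip. On a common mode the operators are `X` and `Y`.
  · rcases hle.lt_or_eq with hlt | heq
    · rw [jwSign_flipBit_of_le hle, jwSign_flipBit_of_lt hlt, flipBit_apply_of_ne hlt.ne,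
        flipBit_apply_of_ne hlt.ne']
      ring
    · have hk : k.val % 2 ≠ k'.val % 2 := by
        intro e
        have : k.val / 2 = k'.val / 2 := congrArg Fin.val heq
        exact h (Fin.ext (by omega))
      rw [heq, jwSign_flipBit_of_le le_rfl, flipBit_apply_self]
      unfold pauliPhase
      rcases Nat.mod_two_eq_zero_or_one k.val with h0 | h0 <;>
      rcases Nat.mod_two_eq_zero_or_one k'.val with h1 | h1 <;>
      cases t (mode k') <;> simp_all [mul_comm]
  · simp

lemma majorana_mul_majorana_mul (k : Fin (2 * n)) (X : FockOp n) :
    majorana n k * (majorana n k * X) = X := by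
  rw [← mul_assoc, majorana_mul_self, one_mul]

lemma majorana_ne_zero_hammingDist_le {k : Fin (2 * n)} {s t : Fin n → Bool}
    (h : majorana n k s t ≠ 0) : hammingDist s t ≤ 1 := by
  rw [majorana_eq, shiftOp, of_apply] at h
  have hs : s = flipBit (mode k) t := by
    by_contra hs
    exact h (if_neg hs)
  rw [hs, hammingDist, ← Finset.card_singleton (mode k)]
  refine Finset.card_le_card fun i hi => ?_
  rw [Finset.mem_singleton]
  by_contra hne
  exact (Finset.mem_filter.1 hi).2 (flipBit_apply_of_ne hne t)

lemma majorana_mem_unitary (k : Fin (2 * n)) : majorana n k ∈ unitary (FockOp n) := by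
  rw [Unitary.mem_iff, star_eq_conjTranspose, majorana_conjTranspose, majorana_mul_self]
  exact ⟨rfl, rfl⟩

/-! ### Products of Majorana operators -/

/-- The product of the Majorana operators with the listed indices. -/
noncomputable def majProd (ls : List (Fin (2 * n))) : FockOp n := (ls.map (majorana n)).prod

@[simp] lemma majProd_nil : majProd ([] : List (Fin (2 * n))) = 1 := rfl

@[simp] lemma majProd_cons (a : Fin (2 * n)) (ls : List (Fin (2 * n))) :
    majProd (a :: ls) = majorana n a * majProd ls := by
  simp [majProd]

/-- Moving `c_k` past a factor costs a sign, except past copies of `c_k` itself. -/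
lemma majorana_mul_majProd (k : Fin (2 * n)) (ls : List (Fin (2 * n))) :
    majorana n k * majProd ls =
      (-1 : ℂ) ^ (ls.length + ls.count k) • (majProd ls * majorana n k) := by
  induction ls with
  | nil => simp
  | cons a t ih =>
    rw [majProd_cons]
    rcases eq_or_ne a k with rfl | h
    · rw [List.count_cons_self, List.length_cons, mul_assoc, ← smul_mul_assoc, smul_mul_assoc,
        ← mul_smul_comm]
      congr 1
      rw [ih, show t.length + 1 + (t.count a + 1) = t.length + t.count a + 2 by ring, pow_add _ _ 2]
      norm_num
    · rw [List.count_cons_of_ne h, List.length_cons, ← mul_assoc, majorana_anticomm h.symm,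
        neg_mul, mul_assoc, ih, mul_smul_comm, mul_assoc,
        show t.length + 1 + t.count k = t.length + t.count k + 1 by ring, pow_succ, mul_neg_one,
        neg_smul]

lemma majProd_mem_unitary (ls : List (Fin (2 * n))) : majProd ls ∈ unitary (FockOp n) := by
  refine Submonoid.list_prod_mem _ fun x hx => ?_
  obtain ⟨k, -, rfl⟩ := List.mem_map.1 hx
  exact majorana_mem_unitary k

/-- The adjoint reverses the product, and reversing `r` anticommuting factors costs `r(r-1)/2`
signs. The power of `i` in `C_K` compensates for them. -/
lemma majProd_conjTranspose {ls : List (Fin (2 * n))} (h : ls.Nodup) :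
    (majProd ls)ᴴ = (-1 : ℂ) ^ (ls.length * (ls.length - 1) / 2) • majProd ls := by
  induction ls with
  | nil => simp
  | cons a t ih =>
    obtain ⟨ha, ht⟩ := List.nodup_cons.1 h
    rw [majProd_cons, conjTranspose_mul, ih ht, majorana_conjTranspose, majorana_mul_majProd,
      List.count_eq_zero_of_not_mem ha, List.length_cons, Nat.triangle_succ, add_zero, smul_smul,
      smul_mul_assoc, pow_add, mul_assoc, ← pow_add, Even.neg_one_pow ⟨_, rfl⟩, mul_one]

lemma monomial_eq (K : Finset (Fin (2 * n))) :
    monomial n K = Complex.I ^ (K.card * (K.card - 1) / 2) • majProd (K.sort (· ≤ ·)) := rfl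

lemma majorana_mul_monomial (k : Fin (2 * n)) (K : Finset (Fin (2 * n))) :
    majorana n k * monomial n K =
      (-1 : ℂ) ^ (K.card + if k ∈ K then 1 else 0) • (monomial n K * majorana n k) := by
  have hc : (K.sort (· ≤ ·)).count k = if k ∈ K then 1 else 0 := by
    split_ifs with h
    · exact List.count_eq_one_of_mem (Finset.sort_nodup _ _) ((Finset.mem_sort _).2 h)
    · exact List.count_eq_zero_of_not_mem fun h' => h ((Finset.mem_sort _).1 h')
  rw [monomial_eq, mul_smul_comm, majorana_mul_majProd, hc, Finset.length_sort, smul_mul_assoc,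
    smul_comm]

lemma monomial_conjTranspose (K : Finset (Fin (2 * n))) :
    (monomial n K)ᴴ = monomial n K := by
  rw [monomial_eq, conjTranspose_smul, majProd_conjTranspose (Finset.sort_nodup _ _),
    Finset.length_sort, smul_smul, star_pow, ← mul_pow]
  simp

lemma monomial_mul_self (K : Finset (Fin (2 * n))) : monomial n K * monomial n K = 1 := by
  nth_rewrite 1 [← monomial_conjTranspose K]
  rw [monomial_eq, conjTranspose_smul, smul_mul_smul_comm, star_pow, ← mul_pow,
    ← star_eq_conjTranspose, (Unitary.mem_iff.1 (majProd_mem_unitary _)).1]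
  simp

lemma commute_majorana_monomial {k : Fin (2 * n)} {K : Finset (Fin (2 * n))}
    (hK : Even K.card) (hk : k ∉ K) : Commute (majorana n k) (monomial n K) := by
  have := majorana_mul_monomial k K
  rwa [if_neg hk, add_zero, hK.neg_one_pow, one_smul] at this

lemma majorana_mul_monomial_of_mem {k : Fin (2 * n)} {K : Finset (Fin (2 * n))}
    (hK : Even K.card) (hk : k ∈ K) :
    majorana n k * monomial n K = -(monomial n K * majorana n k) := by
  rw [majorana_mul_monomial, if_pos hk, hK.add_one.neg_one_pow, neg_one_smul]

lemma commute_monomial {K K' : Finset (Fin (2 * n))} (hK' : Even K'.card)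
    (h : Disjoint K K') : Commute (monomial n K) (monomial n K') := by
  rw [monomial_eq K]
  refine Commute.smul_left (Commute.list_prod_left _ _ fun x hx => ?_) _
  obtain ⟨k, hk, rfl⟩ := List.mem_map.1 hx
  exact commute_majorana_monomial hK' (Finset.disjoint_left.1 h ((Finset.mem_sort _).1 hk))

/-! ### Degree and bandwidth -/

/-- The span of the identity and the Majorana operators; its `d`-th power consists of the
polynomials of degree at most `d`. -/
noncomputable def linSpan (n : ℕ) : Submodule ℂ (FockOp n) :=
  Submodule.span ℂ ({1} ∪ Set.range (majorana n))

lemma one_le_linSpan : (1 : Submodule ℂ (FockOp n)) ≤ linSpan n := by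
  rw [Submodule.one_le]
  exact Submodule.subset_span (Or.inl rfl)

lemma majorana_mem_linSpan (k : Fin (2 * n)) : majorana n k ∈ linSpan n :=
  Submodule.subset_span (Or.inr ⟨k, rfl⟩)

lemma linSpan_pow_mono {a b : ℕ} (h : a ≤ b) : linSpan n ^ a ≤ linSpan n ^ b :=
  pow_le_pow_right' one_le_linSpan h

lemma majProd_mem_linSpan_pow (ls : List (Fin (2 * n))) :
    majProd ls ∈ linSpan n ^ ls.length := by
  induction ls with
  | nil => simp
  | cons a t ih =>
    rw [majProd_cons, List.length_cons, pow_succ']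
    exact Submodule.mul_mem_mul (majorana_mem_linSpan a) ih

/-- A repeated factor cancels, so the degree drops by one instead of rising. This is what makes a
quartic gate have degree 3. -/
lemma majProd_mul_majorana_mem {k : Fin (2 * n)} {ls : List (Fin (2 * n))} (hk : k ∈ ls) :
    majProd ls * majorana n k ∈ linSpan n ^ (ls.length - 1) := by
  induction ls with
  | nil => simp at hk
  | cons a t ih =>
    rw [majProd_cons, List.length_cons, Nat.add_sub_cancel]
    by_cases hkt : k ∈ t
    · have h0 : t.length = t.length - 1 + 1 := by
        have := List.length_pos_of_mem hkt; omega
      rw [mul_assoc, h0, pow_succ']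
      exact Submodule.mul_mem_mul (majorana_mem_linSpan a) (ih hkt)
    · obtain rfl : k = a := by simpa [hkt] using hk
      rw [majorana_mul_majProd, smul_mul_assoc, mul_assoc, majorana_mul_self, mul_one]
      exact Submodule.smul_mem _ _ (majProd_mem_linSpan_pow t)

lemma monomial_mul_majorana_mem {k : Fin (2 * n)} {K : Finset (Fin (2 * n))} (hk : k ∈ K) :
    monomial n K * majorana n k ∈ linSpan n ^ (K.card - 1) := by
  rw [monomial_eq, smul_mul_assoc, ← Finset.length_sort (· ≤ ·) (s := K)]
  exact Submodule.smul_mem _ _ (majProd_mul_majorana_mem ((Finset.mem_sort _).2 hk))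

/-- Operators that change at most `d` bits of an occupation string. -/
noncomputable def bandSubmodule (n d : ℕ) : Submodule ℂ (FockOp n) where
  carrier := {A | ∀ s t, A s t ≠ 0 → hammingDist s t ≤ d}
  zero_mem' := fun s t h => absurd rfl h
  add_mem' := fun {A B} hA hB s t h => by
    by_cases hA0 : A s t = 0
    · exact hB s t fun hB0 => h (by rw [Matrix.add_apply, hA0, hB0, add_zero])
    · exact hA s t hA0
  smul_mem' := fun c A hA s t h => hA s t fun h0 => h (by rw [Matrix.smul_apply, h0, smul_zero])

lemma mul_mem_bandSubmodule {a b : ℕ} {A B : FockOp n} (hA : A ∈ bandSubmodule n a)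
    (hB : B ∈ bandSubmodule n b) : A * B ∈ bandSubmodule n (a + b) := by
  intro s t h
  rw [mul_apply] at h
  obtain ⟨u, -, hu⟩ := Finset.exists_ne_zero_of_sum_ne_zero h
  exact (hammingDist_triangle s u t).trans
    (add_le_add (hA s u (left_ne_zero_of_mul hu)) (hB u t (right_ne_zero_of_mul hu)))

lemma one_mem_bandSubmodule (d : ℕ) : (1 : FockOp n) ∈ bandSubmodule n d := by
  intro s t h
  have : s = t := by
    by_contra hst
    exact h (one_apply_ne hst)
  simp [this]

lemma linSpan_pow_le_bandSubmodule (d : ℕ) : linSpan n ^ d ≤ bandSubmodule n d := by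
  induction d with
  | zero =>
    rw [pow_zero, Submodule.one_le]
    exact one_mem_bandSubmodule 0
  | succ d ih =>
    rw [pow_succ, Submodule.mul_le]
    intro A hA B hB
    refine mul_mem_bandSubmodule (ih hA) ?_
    refine (Submodule.span_le.2 ?_ : linSpan n ≤ bandSubmodule n 1) hB
    rintro _ (rfl | ⟨k, rfl⟩)
    · exact one_mem_bandSubmodule 1
    · exact fun s t h => majorana_ne_zero_hammingDist_le h

end Majorana

/-! ### Degree growth under Gaussian unitaries, layers and circuits. -/

section Gates

open Matrix
open scoped Matrix.Norms.L2Operator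

variable {n : ℕ}

/-- When `C²` is scalar, the span of `1` and `C` is a subalgebra. It is finite-dimensional, hence
closed, and so contains the exponential. -/
lemma exp_mem_span_one_self {C : FockOp n} {c : ℂ} (hC : C * C = c • 1) (z : ℂ) :
    ∃ a b : ℂ, NormedSpace.exp (z • C) = a • 1 + b • C := by
  let S : Subalgebra ℂ (FockOp n) :=
    { carrier := {A | ∃ a b : ℂ, A = a • 1 + b • C}
      mul_mem' := by
        rintro _ _ ⟨a, b, rfl⟩ ⟨a', b', rfl⟩
        refine ⟨a * a' + b * b' * c, a * b' + b * a', ?_⟩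
        simp only [mul_add, add_mul, smul_mul_smul_comm, hC, one_mul, mul_one, smul_smul]
        module
      add_mem' := by
        rintro _ _ ⟨a, b, rfl⟩ ⟨a', b', rfl⟩
        exact ⟨a + a', b + b', by module⟩
      algebraMap_mem' := fun r => ⟨r, 0, by rw [Algebra.algebraMap_eq_smul_one]; module⟩ }
  have hcl : IsClosed (S : Set (FockOp n)) :=
    Submodule.closed_of_finiteDimensional (Subalgebra.toSubmodule S)
  exact NormedSpace.exp_mem hcl (x := z • C) ⟨0, z, by module⟩

lemma exp_mem_unitary {A : FockOp n} (hA : Aᴴ = -A) :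
    NormedSpace.exp A ∈ unitary (FockOp n) :=
  let _ : NormedAlgebra ℚ (FockOp n) := NormedAlgebra.restrictScalars ℚ ℂ _
  NormedSpace.exp_mem_unitary_of_mem_skewAdjoint (skewAdjoint.mem_iff.2 hA)

lemma star_exp_of_skew {A : FockOp n} (hA : Aᴴ = -A) :
    star (NormedSpace.exp A) = NormedSpace.exp (-A) := by
  rw [NormedSpace.star_exp, star_eq_conjTranspose, hA]

lemma exp_conj_of_commute {A x : FockOp n} (hA : Aᴴ = -A) (h : Commute A x) :
    NormedSpace.exp A * x * star (NormedSpace.exp A) = x := by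
  rw [h.exp_left.eq, mul_assoc, (Unitary.mem_iff.1 (exp_mem_unitary hA)).2, mul_one]

/-- Moving `x` past the inverse exponential flips the sign of its exponent, so the conjugate is `exp
(zC)` squared times `x`. -/
lemma exp_conj_of_anticommute {C x : FockOp n} {c z : ℂ} (hC : C * C = c • 1)
    (hA : (z • C)ᴴ = -(z • C)) (h : x * C = -(C * x)) :
    ∃ a b : ℂ, NormedSpace.exp (z • C) * x * star (NormedSpace.exp (z • C)) =
      a • x + b • (C * x) := by
  have hs : SemiconjBy x (-(z • C)) (z • C) := by
    rw [SemiconjBy, mul_neg, mul_smul_comm, h, smul_neg, neg_neg, smul_mul_assoc]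
  let _ : NormedAlgebra ℚ (FockOp n) := NormedAlgebra.restrictScalars ℚ ℂ _
  obtain ⟨a, b, hab⟩ := exp_mem_span_one_self hC z
  refine ⟨a * a + b * b * c, a * b + b * a, ?_⟩
  rw [star_exp_of_skew hA, mul_assoc, hs.exp_right.eq, hab]
  simp only [add_mul, mul_add, smul_mul_assoc, mul_smul_comm, one_mul, ← mul_assoc C, hC]
  module

/-! ### Conjugation and degree -/

/-- Conjugation by a unitary. -/
noncomputable def conjHom {U : FockOp n} (hU : U ∈ unitary (FockOp n)) : FockOp n →ₐ[ℂ] FockOp n :=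
  AlgHom.ofLinearMap
    { toFun := fun X => U * X * star U
      map_add' := fun X Y => by rw [mul_add, add_mul]
      map_smul' := fun c X => by simp }
    (by simp [(Unitary.mem_iff.1 hU).2])
    (fun X Y => by
      change U * (X * Y) * star U = U * X * star U * (U * Y * star U)
      rw [show U * X * star U * (U * Y * star U) = U * X * (star U * U) * Y * star U by
        simp only [mul_assoc], (Unitary.mem_iff.1 hU).1, mul_one]
      simp only [mul_assoc])

lemma conjHom_apply {U : FockOp n} (hU : U ∈ unitary (FockOp n)) (X : FockOp n) :
    conjHom hU X = U * X * star U := rfl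

/-- A unitary whose conjugation turns every Majorana operator into a polynomial of degree at
most `d`. -/
def HasDegree (n d : ℕ) (U : FockOp n) : Prop :=
  U ∈ unitary (FockOp n) ∧ ∀ k, U * majorana n k * star U ∈ linSpan n ^ d

/-- Conjugation is an algebra homomorphism, so the degree bound on generators passes to products and
is multiplicative. -/
lemma HasDegree.conj_mem {d e : ℕ} {U X : FockOp n} (h : HasDegree n d U)
    (hX : X ∈ linSpan n ^ e) : U * X * star U ∈ linSpan n ^ (d * e) := by
  have h1 : (linSpan n).map (conjHom h.1).toLinearMap ≤ linSpan n ^ d := by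
    rw [Submodule.map_le_iff_le_comap]
    refine Submodule.span_le.2 ?_
    rintro _ (rfl | ⟨k, rfl⟩)
    · change conjHom h.1 1 ∈ linSpan n ^ d
      rw [map_one]
      exact (Submodule.one_le.1 (one_le_pow_of_one_le' one_le_linSpan d))
    · exact h.2 k
  have h2 : (linSpan n ^ e).map (conjHom h.1).toLinearMap ≤ linSpan n ^ (d * e) := by
    rw [Submodule.map_pow, pow_mul]
    exact pow_le_pow_left' h1 e
  exact h2 ⟨X, hX, rfl⟩

lemma hasDegree_one : HasDegree n 1 1 :=
  ⟨one_mem _, fun k => by simpa using majorana_mem_linSpan k⟩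

lemma HasDegree.mul {d e : ℕ} {U V : FockOp n} (hU : HasDegree n d U) (hV : HasDegree n e V) :
    HasDegree n (d * e) (U * V) := by
  refine ⟨mul_mem hU.1 hV.1, fun k => ?_⟩
  have := hU.conj_mem (hV.2 k)
  rw [star_mul]
  simpa only [mul_assoc] using this

/-! ### Gaussian unitaries -/

lemma majorana_mul_skew {k₁ k₂ : Fin (2 * n)} (h : k₁ ≠ k₂) (ω : ℝ) :
    ((-(ω : ℂ)) • (majorana n k₁ * majorana n k₂))ᴴ =
      -((-(ω : ℂ)) • (majorana n k₁ * majorana n k₂)) := by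
  rw [conjTranspose_smul, conjTranspose_mul, majorana_conjTranspose, majorana_conjTranspose,
    majorana_anticomm h.symm]
  simp

lemma majorana_mul_sq {k₁ k₂ : Fin (2 * n)} (h : k₁ ≠ k₂) :
    majorana n k₁ * majorana n k₂ * (majorana n k₁ * majorana n k₂) = (-1 : ℂ) • 1 := by
  rw [mul_assoc, majorana_anticomm h, mul_neg, majorana_mul_majorana_mul, mul_neg,
    majorana_mul_self, neg_one_smul]

lemma hasDegree_gaussian_gate {k₁ k₂ : Fin (2 * n)} (h : k₁ ≠ k₂) (ω : ℝ) :
    HasDegree n 1 (NormedSpace.exp (-((ω : ℂ) • (majorana n k₁ * majorana n k₂)))) := by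
  have hs := majorana_mul_skew h ω
  rw [← neg_smul]
  refine ⟨exp_mem_unitary hs, fun k => ?_⟩
  rw [pow_one]
  by_cases hk₁ : k = k₁
  · subst hk₁
    obtain ⟨a, b, hab⟩ := exp_conj_of_anticommute (majorana_mul_sq h) hs
      (x := majorana n k) (by
        rw [majorana_mul_majorana_mul, mul_assoc, majorana_anticomm h.symm, mul_neg,
          majorana_mul_majorana_mul, neg_neg])
    rw [hab, mul_assoc, majorana_anticomm h.symm, mul_neg, majorana_mul_majorana_mul]
    exact Submodule.add_mem _ (Submodule.smul_mem _ _ (majorana_mem_linSpan _))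
      (Submodule.smul_mem _ _ (Submodule.neg_mem _ (majorana_mem_linSpan _)))
  · by_cases hk₂ : k = k₂
    · subst hk₂
      obtain ⟨a, b, hab⟩ := exp_conj_of_anticommute (majorana_mul_sq h) hs
        (x := majorana n k) (by
          rw [majorana_anticomm h, mul_neg, majorana_mul_majorana_mul, neg_mul, mul_assoc,
            majorana_anticomm h, mul_neg, majorana_mul_majorana_mul, neg_neg])
      rw [hab, mul_assoc, majorana_mul_self, mul_one]
      exact Submodule.add_mem _ (Submodule.smul_mem _ _ (majorana_mem_linSpan _))
        (Submodule.smul_mem _ _ (majorana_mem_linSpan _))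
    · rw [exp_conj_of_commute hs]
      · exact majorana_mem_linSpan _
      · refine Commute.smul_left ?_ _
        rw [commute_iff_eq, mul_assoc, majorana_anticomm (Ne.symm hk₂), mul_neg, ← mul_assoc,
          majorana_anticomm (Ne.symm hk₁), neg_mul, neg_neg, mul_assoc]

lemma IsGaussianUnitary.hasDegree {G : FockOp n} (hG : IsGaussianUnitary n G) :
    HasDegree n 1 G := by
  induction hG using Submonoid.closure_induction with
  | mem x hx =>
    obtain ⟨ω, k₁, k₂, h, rfl⟩ := hx
    exact hasDegree_gaussian_gate h ω
  | one => exact hasDegree_one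
  | mul x y _ _ hx hy => exact hx.mul hy

/-! ### Layers and circuits -/

/-- The gate `exp (i ω C_K)`. -/
noncomputable def gate (g : Finset (Fin (2 * n)) × ℝ) : FockOp n :=
  NormedSpace.exp ((Complex.I * (g.2 : ℂ)) • monomial n g.1)

lemma gate_skew (g : Finset (Fin (2 * n)) × ℝ) :
    ((Complex.I * (g.2 : ℂ)) • monomial n g.1)ᴴ = -((Complex.I * (g.2 : ℂ)) • monomial n g.1) := by
  rw [conjTranspose_smul, monomial_conjTranspose]
  simp

lemma gate_mem_unitary (g : Finset (Fin (2 * n)) × ℝ) : gate g ∈ unitary (FockOp n) :=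
  exp_mem_unitary (gate_skew g)

lemma gate_conj_of_notMem {g : Finset (Fin (2 * n)) × ℝ} (hg : Even g.1.card) {k : Fin (2 * n)}
    (hk : k ∉ g.1) : gate g * majorana n k * star (gate g) = majorana n k :=
  exp_conj_of_commute (gate_skew g) ((commute_majorana_monomial hg hk).symm.smul_left _)

lemma gate_conj_mem {g : Finset (Fin (2 * n)) × ℝ} (hg : g.1.card = 2 ∨ g.1.card = 4)
    (k : Fin (2 * n)) : gate g * majorana n k * star (gate g) ∈ linSpan n ^ 3 := by
  have heven : Even g.1.card := by rcases hg with h | h <;> rw [h] <;> decide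
  have h1 : majorana n k ∈ linSpan n ^ 3 :=
    linSpan_pow_mono (by norm_num : 1 ≤ 3) (by simpa using majorana_mem_linSpan k)
  by_cases hk : k ∈ g.1
  · obtain ⟨a, b, hab⟩ := exp_conj_of_anticommute (c := 1)
      ((monomial_mul_self g.1).trans (one_smul _ _).symm) (gate_skew g)
      (majorana_mul_monomial_of_mem heven hk)
    rw [gate, hab]
    refine Submodule.add_mem _ (Submodule.smul_mem _ _ h1) (Submodule.smul_mem _ _ ?_)
    exact linSpan_pow_mono (by omega) (monomial_mul_majorana_mem hk)
  · rwa [gate_conj_of_notMem heven hk]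

lemma commute_gate {g h : Finset (Fin (2 * n)) × ℝ} (hh : Even h.1.card)
    (hd : Disjoint g.1 h.1) : Commute (gate g) (gate h) :=
  (((commute_monomial hh hd).smul_left _).smul_right _).exp

/-- Disjoint supports let at most one gate act on a given `c_k`, so the degree stays 3 however many
gates there are. The second conjunct supports the induction: it shows that the tail fixes `c_k` when
the head gate acts on it. -/
lemma layer_conj {gates : List (Finset (Fin (2 * n)) × ℝ)}
    (hcard : ∀ g ∈ gates, g.1.card = 2 ∨ g.1.card = 4)
    (hdisj : gates.Pairwise fun g h => Disjoint g.1 h.1) :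
    HasDegree n 3 (gates.map gate).prod ∧ ∀ k, (∀ g ∈ gates, k ∉ g.1) →
      (gates.map gate).prod * majorana n k * star (gates.map gate).prod = majorana n k := by
  induction gates with
  | nil =>
    refine ⟨⟨one_mem _, fun k => ?_⟩, fun k _ => by simp⟩
    exact linSpan_pow_mono (by norm_num : 1 ≤ 3) (by simpa using majorana_mem_linSpan k)
  | cons g gs ih =>
    obtain ⟨hg, hgs⟩ := List.pairwise_cons.1 hdisj
    obtain ⟨⟨hU, hdeg⟩, hfix⟩ := ih (fun x hx => hcard x (by simp [hx])) hgs
    have heven : ∀ x ∈ g :: gs, Even x.1.card := by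
      intro x hx
      rcases hcard x hx with h | h <;> rw [h] <;> decide
    rw [List.map_cons, List.prod_cons]
    set W := (gs.map gate).prod with hW
    have hcomm : Commute (gate g) W := by
      refine Commute.list_prod_right _ _ fun x hx => ?_
      obtain ⟨y, hy, rfl⟩ := List.mem_map.1 hx
      exact commute_gate (heven y (by simp [hy])) (hg y hy)
    have hassoc : ∀ X, gate g * W * X * star (gate g * W) =
        gate g * (W * X * star W) * star (gate g) := by
      intro X
      rw [star_mul]
      simp only [mul_assoc]
    have hcomm' : ∀ X, gate g * W * X * star (gate g * W) =
        W * (gate g * X * star (gate g)) * star W := by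
      intro X
      rw [hcomm.eq, star_mul]
      simp only [mul_assoc]
    refine ⟨⟨mul_mem (gate_mem_unitary g) hU, fun k => ?_⟩, fun k hk => ?_⟩
    · by_cases hkg : k ∈ g.1
      · rw [hassoc, hfix k fun x hx hkx => Finset.disjoint_left.1 (hg x hx) hkg hkx]
        exact gate_conj_mem (hcard g (by simp)) k
      -- Here the head gate fixes `c_k`, so it is commuted inside to act first and then drops out.
      · rw [hcomm', gate_conj_of_notMem (heven g (by simp)) hkg]
        exact hdeg k
    · rw [hassoc, hfix k fun x hx => hk x (by simp [hx]),
        gate_conj_of_notMem (heven g (by simp)) (hk g (by simp))]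

lemma IsLayer.hasDegree {W : FockOp n} (hW : IsLayer n W) : HasDegree n 3 W := by
  obtain ⟨gates, hcard, hdisj, rfl⟩ := hW
  exact (layer_conj hcard hdisj).1

lemma IsCircuit.hasDegree {T : ℕ} {U : FockOp n} (hU : IsCircuit n T U) :
    HasDegree n (3 ^ T) U := by
  induction hU with
  | nil => exact hasDegree_one
  | step _ hW hG ih =>
    rw [pow_succ', ← one_mul (3 * _), ← mul_assoc]
    exact (hG.hasDegree.mul hW.hasDegree).mul ih

end Gates

/-! ### System operators on all modes, the partial trace, and occupation projections. -/

section Embedding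

open Matrix
open scoped Matrix.Norms.L2Operator

variable {l m : ℕ}

/-- The embedding `A ↦ A ⊗ 1` of the operators on `l` modes into those on `l + m` modes. -/
noncomputable def emb (l m : ℕ) : FockOp l →ₐ[ℂ] FockOp (l + m) :=
  AlgHom.ofLinearMap
    { toFun := fun A => (kroneckerMap (· * ·) A (1 : FockOp m)).submatrix
        (Fin.appendEquiv l m).symm (Fin.appendEquiv l m).symm
      map_add' := fun A B => by rw [add_kronecker, submatrix_add]; rfl
      map_smul' := fun c A => by rw [smul_kronecker, submatrix_smul]; rfl }
    (by
      change (kroneckerMap (· * ·) (1 : FockOp l) (1 : FockOp m)).submatrix _ _ = 1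
      rw [one_kronecker_one, submatrix_one_equiv])
    (fun A B => by
      change (kroneckerMap (· * ·) (A * B) (1 : FockOp m)).submatrix _ _ =
        (kroneckerMap (· * ·) A (1 : FockOp m)).submatrix _ _ *
        (kroneckerMap (· * ·) B (1 : FockOp m)).submatrix _ _
      rw [submatrix_mul_equiv, ← mul_kronecker_mul, one_mul])

lemma emb_apply (A : FockOp l) (s t : Fin (l + m) → Bool) :
    emb l m A s t = A (fun i => s (Fin.castAdd m i)) (fun i => t (Fin.castAdd m i)) *
      if (fun i => s (Fin.natAdd l i)) = fun i => t (Fin.natAdd l i) then 1 else 0 := by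
  change (kroneckerMap (· * ·) A (1 : FockOp m)).submatrix _ _ s t = _
  rw [submatrix_apply, kroneckerMap_apply, one_apply]
  rfl

lemma emb_conjTranspose (A : FockOp l) : (emb l m A)ᴴ = emb l m Aᴴ := by
  ext s t
  simp only [conjTranspose_apply, emb_apply, star_mul', eq_comm (a := fun i => s (Fin.natAdd l i))]
  split_ifs <;> simp

/-- The inclusion of the indices of the system Majorana operators. -/
def castIdx (l m : ℕ) : Fin (2 * l) ↪ Fin (2 * (l + m)) :=
  Fin.castLEEmb (by omega)

/-- System modes precede ancillas in the Jordan–Wigner order, so their sign strings never reach an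
ancilla. -/
lemma emb_majorana (k : Fin (2 * l)) :
    emb l m (majorana l k) = majorana (l + m) (castIdx l m k) := by
  have hmode : mode (castIdx l m k) = Fin.castAdd m (mode k) := rfl
  have hval : (castIdx l m k).val = k.val := rfl
  ext s t
  have hsign : jwSign (Fin.castAdd m (mode k)) t =
      jwSign (mode k) (fun i => t (Fin.castAdd m i)) := by
    rw [jwSign, Fin.prod_univ_add, jwSign]
    rw [Finset.prod_eq_one (s := Finset.univ) (f := fun i : Fin m => _), mul_one]
    · rfl
    · intro i _
      rw [if_neg]
      rintro ⟨h, -⟩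
      rw [Fin.lt_def] at h
      have := (mode k).isLt
      simp at h
      omega
  have hiff : s = flipBit (Fin.castAdd m (mode k)) t ↔
      (fun i => s (Fin.castAdd m i)) = flipBit (mode k) (fun i => t (Fin.castAdd m i)) ∧
      (fun i => s (Fin.natAdd l i)) = fun i => t (Fin.natAdd l i) := by
    have h1 : (fun i => flipBit (Fin.castAdd m (mode k)) t (Fin.castAdd m i)) =
        flipBit (mode k) (fun i => t (Fin.castAdd m i)) := by
      ext i
      by_cases h : i = mode k
      · subst h; rw [flipBit_apply_self, flipBit_apply_self]
      · rw [flipBit_apply_of_ne h, flipBit_apply_of_ne]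
        exact fun e => h (Fin.castAdd_injective _ _ e)
    have h2 : (fun i => flipBit (Fin.castAdd m (mode k)) t (Fin.natAdd l i)) =
        fun i => t (Fin.natAdd l i) := by
      ext i
      rw [flipBit_apply_of_ne]
      intro e
      have := congrArg Fin.val e
      have := (mode k).isLt
      simp at *
      omega
    constructor
    · rintro rfl
      exact ⟨h1, h2⟩
    · rintro ⟨e1, e2⟩
      ext i
      refine Fin.addCases (fun i => ?_) (fun i => ?_) i
      · exact congrFun (e1.trans h1.symm) i
      · exact congrFun (e2.trans h2.symm) i
  rw [emb_apply, majorana_eq, majorana_eq, shiftOp, shiftOp, of_apply, of_apply, hmode, hval,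
    hsign]
  simp only [hiff]
  split_ifs <;> simp_all

lemma emb_monomial (K : Finset (Fin (2 * l))) :
    emb l m (monomial l K) = monomial (l + m) (K.map (castIdx l m)) := by
  have hsort : (K.sort (· ≤ ·)).map (castIdx l m) = (K.map (castIdx l m)).sort (· ≤ ·) :=
    Finset.map_sort (castIdx l m) K (· ≤ ·) (· ≤ ·) fun _ _ _ _ => Iff.rfl
  rw [monomial_eq, monomial_eq, Finset.card_map, map_smul, ← hsort, majProd, majProd,
    map_list_prod, List.map_map, List.map_map]
  congr 3
  funext k
  exact emb_majorana k

lemma IsGaussianUnitary.emb {G : FockOp l} (hG : IsGaussianUnitary l G) :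
    IsGaussianUnitary (l + m) (FermiCircuit.emb l m G) := by
  induction hG using Submonoid.closure_induction with
  | mem x hx =>
    obtain ⟨ω, k₁, k₂, h, rfl⟩ := hx
    refine Submonoid.subset_closure ⟨ω, castIdx l m k₁, castIdx l m k₂,
      fun e => h ((castIdx l m).injective e), ?_⟩
    let _ : NormedAlgebra ℚ (FockOp l) := NormedAlgebra.restrictScalars ℚ ℂ _
    rw [NormedSpace.map_exp (FermiCircuit.emb l m)
      (LinearMap.continuous_of_finiteDimensional (FermiCircuit.emb l m).toLinearMap), map_neg,
      map_smul, map_mul, emb_majorana, emb_majorana]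
  | one => rw [map_one]; exact Submonoid.one_mem _
  | mul x y _ _ hx hy => rw [map_mul]; exact Submonoid.mul_mem _ hx hy

/-! ### The partial trace -/

variable {n : ℕ}

lemma trace_eq_zero_of_anticommute {k : Fin (2 * n)} {X : FockOp n}
    (h : majorana n k * X = -(X * majorana n k)) : X.trace = 0 := by
  have h1 : (majorana n k * (X * majorana n k)).trace = X.trace := by
    rw [trace_mul_comm, mul_assoc, majorana_mul_self, mul_one]
  rw [← mul_assoc, h, neg_mul, mul_assoc, majorana_mul_self, mul_one, trace_neg] at h1
  exact self_eq_neg.1 h1.symm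

lemma trace_monomial_mul_of_ne {J K : Finset (Fin (2 * n))} (h : J ≠ K) :
    (monomial n J * monomial n K).trace = 0 := by
  have hk : ∃ k, Odd ((J.card + if k ∈ J then 1 else 0) + (K.card + if k ∈ K then 1 else 0)) := by
    by_contra hcon
    push Not at hcon
    rcases Nat.even_or_odd (J.card + K.card) with he | ho
    · refine h (Finset.ext fun k => ?_)
      have := hcon k
      by_cases h1 : k ∈ J <;> by_cases h2 : k ∈ K <;> simp only [h1, h2, if_true, if_false] at this ⊢
      all_goals grind
    -- If every `c_k` commutes with `C_J C_K` and `|J| + |K|` is odd, each index lies in exactly one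
    -- of `J`, `K`. Then `|J| + |K| = 2n` is even, a contradiction.
    · have hc : K = Jᶜ := by
        ext k
        have := hcon k
        rw [Finset.mem_compl]
        by_cases h1 : k ∈ J <;> by_cases h2 : k ∈ K <;>
          simp only [h1, h2, if_true, if_false] at this ⊢
        all_goals grind
      rw [hc, Finset.card_add_card_compl, Fintype.card_fin] at ho
      exact (Nat.not_odd_iff_even.2 (even_two_mul n)) ho
  obtain ⟨k, hk⟩ := hk
  refine trace_eq_zero_of_anticommute (k := k) ?_
  rw [← mul_assoc, majorana_mul_monomial, smul_mul_assoc, mul_assoc, majorana_mul_monomial,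
    mul_smul_comm, smul_smul, ← pow_add, hk.neg_one_pow, neg_one_smul, mul_assoc]

lemma trace_monomial_mul_self (K : Finset (Fin (2 * n))) :
    (monomial n K * monomial n K).trace = 2 ^ n := by
  rw [monomial_mul_self, trace_one]
  simp

lemma linearIndependent_monomial : LinearIndependent ℂ (monomial n) := by
  rw [linearIndependent_iff']
  intro s g hg J hJ
  have h := congrArg (fun X => (monomial n J * X).trace) hg
  simp only [Finset.mul_sum, mul_smul_comm, trace_sum, trace_smul, mul_zero, trace_zero,
    smul_eq_mul] at h
  rw [Finset.sum_eq_single J (fun K _ hK => by rw [trace_monomial_mul_of_ne hK.symm, mul_zero])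
    (fun h => absurd hJ h), trace_monomial_mul_self] at h
  exact (mul_eq_zero.1 h).resolve_right (pow_ne_zero _ two_ne_zero)

/-- Trace orthogonality gives independence, and there are `2^(2n) = 4^n` monomials, the dimension of
the matrix algebra. -/
lemma span_monomial : Submodule.span ℂ (Set.range (monomial n)) = ⊤ := by
  refine linearIndependent_monomial.span_eq_top_of_card_eq_finrank' ?_
  rw [Module.finrank_matrix]
  simp [two_mul, pow_add]

/-- The partial trace is dual to `A ↦ A ⊗ 1`. By linearity it suffices to test monomials, where
orthogonality picks out one term. -/
lemma trace_mul_partialTrace (X : FockOp l) (Y : FockOp (l + m)) :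
    (X * partialTrace l m Y).trace = (emb l m X * Y).trace := by
  have hX : X ∈ Submodule.span ℂ (Set.range (monomial l)) := by
    rw [span_monomial]; trivial
  induction hX using Submodule.span_induction with
  | mem x hx =>
    obtain ⟨J, rfl⟩ := hx
    simp only [partialTrace, Finset.mul_sum, mul_smul_comm, trace_sum, trace_smul, smul_eq_mul]
    rw [Finset.sum_eq_single J
      (fun K _ hK => by rw [trace_monomial_mul_of_ne hK.symm, mul_zero]) (by simp),
      trace_monomial_mul_self, emb_monomial, mul_right_comm,
      inv_mul_cancel₀ (pow_ne_zero _ two_ne_zero), one_mul]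
    rfl
  | zero => simp
  | add x y _ _ hx hy => rw [add_mul, trace_add, hx, hy, map_add, add_mul, trace_add]
  | smul c x _ hx => rw [smul_mul_assoc, trace_smul, hx, map_smul, smul_mul_assoc, trace_smul]

/-! ### The occupation projections -/

/-- The Hermitian reflection `(-1)^{s_j} i c_{2j} c_{2j+1}`. -/
noncomputable def modeReflection (s : Fin n → Bool) (j : Fin n) : FockOp n :=
  ((if s j = true then (-1 : ℂ) else 1) * Complex.I) •
    (majorana n ⟨2 * j.val, by omega⟩ * majorana n ⟨2 * j.val + 1, by omega⟩)

lemma occupationProj_eq_prod (s : Fin n → Bool) :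
    occupationProj n s =
      ((List.finRange n).map fun j => (2⁻¹ : ℂ) • (1 + modeReflection s j)).prod := rfl

lemma modeReflection_mem (s : Fin n → Bool) (j : Fin n) :
    modeReflection s j ∈ linSpan n ^ 2 := by
  rw [sq]
  exact Submodule.smul_mem _ _
    (Submodule.mul_mem_mul (majorana_mem_linSpan _) (majorana_mem_linSpan _))

lemma modeReflection_conjTranspose (s : Fin n → Bool) (j : Fin n) :
    (modeReflection s j)ᴴ = modeReflection s j := by
  rw [modeReflection, conjTranspose_smul, conjTranspose_mul, majorana_conjTranspose,
    majorana_conjTranspose, majorana_anticomm (by simp [Fin.ext_iff])]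
  split_ifs <;> simp

lemma modeReflection_mul_self (s : Fin n → Bool) (j : Fin n) :
    modeReflection s j * modeReflection s j = 1 := by
  rw [modeReflection, smul_mul_smul_comm, majorana_mul_sq (by simp [Fin.ext_iff]), smul_smul]
  split_ifs <;> simp

lemma modeReflection_eq_diagonal (s : Fin n → Bool) (j : Fin n) :
    modeReflection s j = diagonal fun t => if t j = !s j then 1 else -1 := by
  have h0 : mode (⟨2 * j.val, by omega⟩ : Fin (2 * n)) = j := by
    apply Fin.ext; simp [mode]
  have h1 : mode (⟨2 * j.val + 1, by omega⟩ : Fin (2 * n)) = j := by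
    apply Fin.ext; simp [mode]; omega
  rw [modeReflection, majorana_eq, majorana_eq, shiftOp_mul, h0, h1]
  ext u t
  rw [Matrix.smul_apply, shiftOp, of_apply, diagonal_apply, Function.comp_apply, flipBit_flipBit,
    jwSign_flipBit_of_le le_rfl, mul_mul_mul_comm, jwSign_mul_self]
  by_cases hu : u = t
  · subst hu
    cases u j <;> cases s j <;> simp [pauliPhase, Nat.add_mod]
  · simp [hu]

lemma list_prod_diagonal {α : Type*} [Fintype α] [DecidableEq α] (ls : List (α → ℂ)) :
    (ls.map diagonal).prod = (diagonal ls.prod : Matrix α α ℂ) :=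
  ((diagonalRingHom α ℂ).map_list_prod ls).symm

/-- In this representation `i c_{2j} c_{2j+1} = -Z_j`, so the outcome `s` selects the complementary
string. This is why `readout` negates bits. -/
lemma occupationProj_eq_diagonal (s : Fin n → Bool) :
    occupationProj n s = diagonal fun t => if t = (fun j => !s j) then 1 else 0 := by
  have h : ∀ j, (2⁻¹ : ℂ) • (1 + modeReflection s j) =
      diagonal fun t => if t j = !s j then 1 else 0 := by
    intro j
    rw [modeReflection_eq_diagonal, ← diagonal_one, diagonal_add, ← diagonal_smul]
    congr 1
    ext t
    simp only [Pi.smul_apply, smul_eq_mul]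
    split_ifs <;> norm_num
  rw [occupationProj_eq_prod, funext h,
    show (fun j => (diagonal fun t : Fin n → Bool => if t j = !s j then (1 : ℂ) else 0)) =
      diagonal ∘ fun j t => if t j = !s j then (1 : ℂ) else 0 from rfl, ← List.map_map,
    list_prod_diagonal]
  congr 1
  ext t
  rw [← Fin.prod_univ_def, Finset.prod_apply]
  simp [Finset.prod_ite_zero, funext_iff]

lemma occupationProj_conj (s : Fin n → Bool) (X : FockOp n) :
    occupationProj n s * X * occupationProj n s =
      (X * occupationProj n s).trace • occupationProj n s := by
  rw [occupationProj_eq_diagonal]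
  set u : Fin n → Bool := fun j => !s j
  have htr : (X * diagonal fun t => if t = u then (1 : ℂ) else 0).trace = X u u := by
    simp [trace, mul_diagonal]
  rw [htr]
  ext a b
  rw [mul_diagonal, diagonal_mul, Matrix.smul_apply, diagonal_apply, smul_eq_mul]
  by_cases ha : a = u <;> by_cases hb : b = u <;> by_cases hab : a = b <;> simp_all

lemma occupationProj_mul_self (s : Fin n → Bool) :
    occupationProj n s * occupationProj n s = occupationProj n s := by
  simp [occupationProj_eq_diagonal]

lemma occupationProj_conjTranspose (s : Fin n → Bool) :
    (occupationProj n s)ᴴ = occupationProj n s := by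
  rw [occupationProj_eq_diagonal, diagonal_conjTranspose]
  congr 1
  ext t
  by_cases h : t = fun j => !s j <;> simp [h]

/-- The outcome read off from the system modes of an occupation string. -/
def readout (l m : ℕ) (t : Fin (l + m) → Bool) : Fin l → Bool :=
  fun j => !(t (Fin.castAdd m j))

lemma sum_emb_occupationProj (S : Finset (Fin l → Bool)) :
    ∑ s ∈ S, emb l m (occupationProj l s) = diagProj {t | readout l m t ∈ S} := by
  ext a b
  rw [Matrix.sum_apply, diagProj, diagonal_apply]
  have h : ∀ s, emb l m (occupationProj l s) a b =
      if s = readout l m a then (if a = b then 1 else 0) else 0 := by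
    intro s
    have e1 : ((fun i => a (Fin.castAdd m i)) = fun j => !s j) ↔ s = readout l m a := by
      simp only [funext_iff, readout]
      refine forall_congr' fun j => ?_
      cases a (Fin.castAdd m j) <;> cases s j <;> simp
    have e2 : a = b ↔ ((fun i => a (Fin.castAdd m i)) = fun i => b (Fin.castAdd m i)) ∧
        (fun i => a (Fin.natAdd l i)) = fun i => b (Fin.natAdd l i) := by
      refine ⟨by rintro rfl; exact ⟨rfl, rfl⟩, fun ⟨h1, h2⟩ => funext fun i => ?_⟩
      refine Fin.addCases (fun i => ?_) (fun i => ?_) i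
      · exact congrFun h1 i
      · exact congrFun h2 i
    rw [emb_apply, occupationProj_eq_diagonal, diagonal_apply]
    simp only [e1, e2]
    split_ifs <;> simp_all
  simp only [h]
  split_ifs <;> simp_all

end Embedding

/-! ### Concentration against spreading. -/

section Spread

open Matrix
open scoped Matrix.Norms.L2Operator

variable {n l m : ℕ}

/-- The concentration bound: the rank-one projection obtained from an occupation state by a
unitary of degree `d` has exponentially small blocks between far-apart sets of strings. -/
lemma norm_block_le {d L : ℕ} (hd : 0 < d) {W : FockOp n} (hW : HasDegree n d W)
    (s : Fin n → Bool) {F : (Fin n → Bool) → ℤ}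
    (hF : ∀ a b, |F a - F b| ≤ hammingDist a b) {S₁ S₂ : Set (Fin n → Bool)}
    [DecidablePred (· ∈ S₁)] [DecidablePred (· ∈ S₂)]
    (h₁ : ∀ a ∈ S₁, F a = 0) (h₂ : ∀ a ∈ S₂, (L : ℤ) ≤ F a) {t : ℝ} (ht : 0 ≤ t)
    (htd : t * (2 * d) < 1) :
    ‖diagProj S₂ * (W * occupationProj n s * Wᴴ) * diagProj S₁‖ ≤
      Real.exp (32 * n * d ^ 2 * t ^ 2 - t * L) := by
  have hW1 : star W * W = 1 := (Unitary.mem_iff.1 hW.1).1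
  set q : Fin n → FockOp n := fun j => (2⁻¹ : ℂ) • (1 + W * modeReflection s j * star W) with hq
  have hprod : W * occupationProj n s * Wᴴ = ((List.finRange n).map q).prod := by
    rw [← star_eq_conjTranspose, ← conjHom_apply hW.1, occupationProj_eq_prod, map_list_prod,
      List.map_map]
    congr 2
    funext j
    rw [Function.comp_apply, map_smul, map_add, map_one, conjHom_apply]
  have hqle : ∀ j, ‖tilt F t (q j)‖ ≤ Real.exp (8 * (2 * d) ^ 2 * t ^ 2) := by
    intro j
    -- A mode reflection is quadratic, so its conjugate has degree, hence bandwidth, at most `2d`.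
    -- The exponent `8 (2d)² t²` per mode is the origin of the constant 32.
    have hband := linSpan_pow_le_bandSubmodule _ (hW.conj_mem (modeReflection_mem s j))
    have := norm_tilt_projection_le (F := F) (D := d * 2) (by omega)
      (A := W * modeReflection s j * star W)
      (fun a b hab => (hF a b).trans (by exact_mod_cast hband a b hab))
      (by
        rw [star_eq_conjTranspose, conjTranspose_mul, conjTranspose_mul,
          conjTranspose_conjTranspose, modeReflection_conjTranspose, mul_assoc])
      (by
        rw [← conjHom_apply hW.1, ← map_mul, modeReflection_mul_self, map_one])
      ht (by push_cast; linarith)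
    refine this.trans_eq ?_
    push_cast
    ring_nf
  have htilt : ‖tilt F t (W * occupationProj n s * Wᴴ)‖ ≤ Real.exp (32 * n * d ^ 2 * t ^ 2) := by
    rw [hprod, tilt_list_prod, List.map_map]
    have := norm_list_prod_le_pow (l := (List.finRange n).map (tilt F t ∘ q))
      (c := Real.exp (8 * (2 * d) ^ 2 * t ^ 2)) (Real.one_le_exp (by positivity)) (by
        intro x hx
        obtain ⟨j, -, rfl⟩ := List.mem_map.1 hx
        exact hqle j)
    refine this.trans_eq ?_
    rw [List.length_map, List.length_finRange, ← Real.exp_nat_mul]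
    ring_nf
  refine (norm_diagProj_mul_le h₁ h₂ _ ht).trans ?_
  rw [sub_eq_neg_add, Real.exp_add]
  gcongr

/-- The Hamming distance of the readout to a set of outcomes. -/
noncomputable def distTo (l m : ℕ) (S : Finset (Fin l → Bool)) (hS : S.Nonempty)
    (t : Fin (l + m) → Bool) : ℕ :=
  S.inf' hS fun s => hammingDist s (readout l m t)

lemma hammingDist_readout_le (a b : Fin (l + m) → Bool) :
    hammingDist (readout l m a) (readout l m b) ≤ hammingDist a b := by
  rw [hammingDist, hammingDist, ← Finset.card_map (Fin.castAddEmb m)]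
  refine Finset.card_le_card fun i hi => ?_
  obtain ⟨j, hj, rfl⟩ := Finset.mem_map.1 hi
  simpa [readout] using hj

lemma distTo_le_add (S : Finset (Fin l → Bool)) (hS : S.Nonempty) (a b : Fin (l + m) → Bool) :
    distTo l m S hS a ≤ distTo l m S hS b + hammingDist a b := by
  obtain ⟨s, hs, he⟩ := Finset.exists_mem_eq_inf' hS fun s => hammingDist s (readout l m b)
  rw [distTo, distTo, he]
  refine (Finset.inf'_le _ hs).trans ((hammingDist_triangle _ (readout l m b) _).trans ?_)
  rw [hammingDist_comm a]
  exact Nat.add_le_add_left (hammingDist_readout_le b a) _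

lemma abs_distTo_sub_le (S : Finset (Fin l → Bool)) (hS : S.Nonempty)
    (a b : Fin (l + m) → Bool) :
    |(distTo l m S hS a : ℤ) - distTo l m S hS b| ≤ hammingDist a b := by
  have h1 := distTo_le_add S hS a b
  have h2 := distTo_le_add S hS b a
  rw [hammingDist_comm] at h2
  rw [abs_le]
  omega

/-- Outcome probabilities of a reduced state, evaluated on all modes. -/
lemma sum_outcomeProb_partialTrace (S : Finset (Fin l → Bool)) (G : FockOp l)
    (Y : FockOp (l + m)) :
    ∑ s ∈ S, outcomeProb l G (partialTrace l m Y) s =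
      (diagProj {t | readout l m t ∈ S} * (emb l m G * Y * (emb l m G)ᴴ)).trace.re := by
  rw [← sum_emb_occupationProj, Finset.sum_mul, trace_sum, Complex.re_sum]
  refine Finset.sum_congr rfl fun s _ => ?_
  rw [outcomeProb, povm, trace_mul_partialTrace, map_mul, map_mul, ← emb_conjTranspose]
  congr 1
  rw [mul_assoc, mul_assoc, trace_mul_comm]
  simp only [mul_assoc]

/-- The probabilities of two sets of outcomes at distance `L` cannot both be large. -/
lemma le_exp_of_spread {L T : ℕ} {μ : ℝ} (hμ : 0 < μ) {ρ : FockOp l} (hL : 0 < L)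
    (hspread : IsSpread l μ L ρ) (hprep : IsPreparedBy l m T ρ) :
    L ≤ l ∧ μ ≤ Real.exp (-(L ^ 2 / (128 * (l + m) * 9 ^ T))) := by
  obtain ⟨G, hG, S₁, S₂, hp₁, hp₂, ⟨s₁, hs₁, s₂, hs₂, hd⟩, hmin⟩ := hspread
  obtain ⟨σ, U, ⟨V, hV, s, rfl⟩, hU, rfl⟩ := hprep
  have hLl : L ≤ l := by
    rw [← hd]
    exact hammingDist_le_card_fintype.trans_eq (Fintype.card_fin l)
  refine ⟨hLl, ?_⟩
  have hS₁ : S₁.Nonempty := ⟨s₁, hs₁⟩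
  -- State preparation, circuit and measurement basis merge into one unitary; the two Gaussian
  -- factors leave its degree at `3 ^ T`.
  set W : FockOp (l + m) := emb l m G * U * V with hWdef
  have hW : HasDegree (l + m) (3 ^ T) W := by
    have := ((hG.emb (m := m)).hasDegree.mul hU.hasDegree).mul hV.hasDegree
    rwa [one_mul, mul_one] at this
  have hW1 : Wᴴ * W = 1 := (Unitary.mem_iff.1 hW.1).1
  set R : FockOp (l + m) := W * occupationProj (l + m) s * Wᴴ with hR
  have hRY : emb l m G * (U * (V * occupationProj (l + m) s * Vᴴ) * Uᴴ) * (emb l m G)ᴴ = R := by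
    rw [hR, hWdef, conjTranspose_mul, conjTranspose_mul]
    simp only [mul_assoc]
  rw [sum_outcomeProb_partialTrace, hRY] at hp₁ hp₂
  clear_value W
  have hRh : Rᴴ = R := by
    rw [hR, conjTranspose_mul, conjTranspose_mul, conjTranspose_conjTranspose,
      occupationProj_conjTranspose, mul_assoc]
  have hR2 : R * R = R := by
    rw [hR, show W * occupationProj (l + m) s * Wᴴ * (W * occupationProj (l + m) s * Wᴴ) =
      W * (occupationProj (l + m) s * (Wᴴ * W) * occupationProj (l + m) s) * Wᴴ by
        simp only [mul_assoc], hW1, mul_one, occupationProj_mul_self]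
  have hrank : ∀ X, R * X * R = (X * R).trace • R := by
    intro X
    rw [hR, show W * occupationProj (l + m) s * Wᴴ * X * (W * occupationProj (l + m) s * Wᴴ) =
      W * (occupationProj (l + m) s * (Wᴴ * X * W) * occupationProj (l + m) s) * Wᴴ by
        simp only [mul_assoc], occupationProj_conj, mul_smul_comm, smul_mul_assoc]
    congr 1
    rw [show Wᴴ * X * W * occupationProj (l + m) s = Wᴴ * (X * W * occupationProj (l + m) s) by
      simp only [mul_assoc], trace_mul_comm]
    simp only [mul_assoc]
  have hlow := le_norm_of_rank_one hRh hR2 hrank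
    (diagProj_conjTranspose {t | readout l m t ∈ S₁})
    (diagProj_mul_self _) (diagProj_conjTranspose {t | readout l m t ∈ S₂})
    (diagProj_mul_self _) hμ hp₁ hp₂
  have hL' : (0 : ℝ) < L := by exact_mod_cast hL
  have hn : (L : ℝ) ≤ l + m := by
    have : (L : ℝ) ≤ l := by exact_mod_cast hLl
    have : (0 : ℝ) ≤ m := Nat.cast_nonneg m
    linarith
  have hn0 : (0 : ℝ) < l + m := hL'.trans_le hn
  have h3 : (1 : ℝ) ≤ 3 ^ T := one_le_pow₀ (by norm_num)
  have h9 : (9 : ℝ) ^ T = (3 ^ T) ^ 2 := by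
    rw [← pow_mul, mul_comm, pow_mul]; norm_num
  -- The minimiser of `32 n d² t² - tL` with `n = l + m` and `d = 3 ^ T`; the minimum is `-L² / (128
  -- n d²)`.
  set t : ℝ := L / (64 * (l + m) * (3 ^ T) ^ 2) with ht
  have ht0 : 0 ≤ t := by positivity
  -- The Schwarz estimate needs `t` times the bandwidth to be below 1; this holds because `L ≤ l ≤ l
  -- + m`.
  have htd : t * (2 * (3 ^ T : ℕ)) < 1 := by
    push_cast
    rw [ht, div_mul_eq_mul_div, div_lt_one (by positivity)]
    have e1 : (l + m : ℝ) * 3 ^ T ≤ (l + m) * (3 ^ T) ^ 2 := by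
      gcongr
      exact le_self_pow₀ h3 two_ne_zero
    have e2 : (L : ℝ) * 3 ^ T ≤ (l + m) * 3 ^ T := by gcongr
    have e3 : (0 : ℝ) < (l + m) * 3 ^ T := by positivity
    linarith
  have hup := norm_block_le (L := L) (by positivity) hW s
    (F := fun t => (distTo l m S₁ hS₁ t : ℤ)) (abs_distTo_sub_le S₁ hS₁)
    (S₁ := {t | readout l m t ∈ S₁}) (S₂ := {t | readout l m t ∈ S₂})
    (fun a ha => by
      have h0 : distTo l m S₁ hS₁ a ≤ hammingDist (readout l m a) (readout l m a) :=
        Finset.inf'_le _ ha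
      rw [hammingDist_self] at h0
      exact_mod_cast Nat.le_zero.1 h0)
    (fun a ha => by
      have : L ≤ distTo l m S₁ hS₁ a :=
        Finset.le_inf' _ _ fun s hs => hmin ⟨s, hs, readout l m a, ha, rfl⟩
      exact_mod_cast this) ht0 htd
  refine (hlow.trans hup).trans_eq ?_
  congr 1
  rw [h9, ht]
  push_cast
  field_simp
  ring

end Spread

end FermiCircuit

theorem mainTheorem2 (l m L T : ℕ) (μ : ℝ) (hμ : 0 < μ) (ρ : FermiCircuit.FockOp l)
    (hρ : FermiCircuit.IsFermionicState l ρ)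
    (hspread : FermiCircuit.IsSpread l μ L ρ)
    (hprep : FermiCircuit.IsPreparedBy l m T ρ) :
    (1 / 2 : ℝ) * Real.logb 3 ((L : ℝ) ^ 2 / (1600 * ((l : ℝ) + (m : ℝ)) * Real.log (1 / μ)))
      ≤ (T : ℝ) := by
  rcases Nat.eq_zero_or_pos L with rfl | hL
  -- For `L = 0` the argument of the logarithm is 0, and `Real.logb 3 0 = 0` makes the bound
  -- trivial.
  · simp
  obtain ⟨hLl, hle⟩ := FermiCircuit.le_exp_of_spread hμ hL hspread hprep
  have hL0 : (0 : ℝ) < L := by exact_mod_cast hL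
  have hl0 : (0 : ℝ) < l := by exact_mod_cast hL.trans_le hLl
  have hn0 : (0 : ℝ) < (l : ℝ) + m := by positivity
  have hlog : (L : ℝ) ^ 2 / (128 * (l + m) * 9 ^ T) ≤ Real.log (1 / μ) := by
    rw [one_div, Real.log_inv, le_neg]
    exact (Real.log_le_iff_le_exp hμ).2 hle
  -- Positivity of `log (1/μ)`, hence `μ < 1`, is itself a consequence of the concentration bound
  -- when `L > 0`.
  have hlog0 : 0 < Real.log (1 / μ) := lt_of_lt_of_le (by positivity) hlog
  -- The argument yields the constant 128, so 1600 leaves slack.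
  have harg : (L : ℝ) ^ 2 / (1600 * ((l : ℝ) + (m : ℝ)) * Real.log (1 / μ)) ≤ 9 ^ T := by
    rw [div_le_iff₀ (by positivity)] at hlog ⊢
    have : 0 ≤ Real.log (1 / μ) * ((l + m) * 9 ^ T) := by positivity
    nlinarith
  have h9 : Real.logb 3 (9 ^ T) = 2 * T := by
    rw [show (9 : ℝ) = 3 ^ 2 by norm_num, ← pow_mul, Real.logb_pow,
      Real.logb_self_eq_one (by norm_num)]
    push_cast
    ring
  have := Real.logb_le_logb_of_le (b := 3) (by norm_num) (by positivity) harg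
  rw [h9] at this
  linarith
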